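/- Let $K$ be a nonarchimedean local field with ring of integers $\mathcal O$, uniformizer $\varpi$, residue field of cardinality $q$, and absolute value normalized by $|\varpi|=q^{-1}$. Let $G=\mathrm{GL}_n(K)$, let $C=\mathrm{GL}_n(\mathcal O)$, let $M(\mathcal O)$ be the set of $n\times n$ matrices over $\mathcal O$, let $A\subset G$ be the group of diagonal matrices and $N\subset G$ the group of upper triangular matrices with ones on the diagonal. Let $dx$ be the Haar measure on $G$ with $\mathrm{vol}(C)=1$ and $du$ the Haar measure on $N$ with $\mathrm{vol}(N\cap C)=1$. For $a=\mathrm{diag}(a_1,\dots,a_n)\in A$ put $\delta(a)=|a_1|^{n-1}|a_2|^{n-3}\cdots|a_n|^{-(n-1)}$, and for a function $f$ on $G$ let $$Sf(a)=\delta(a)^{1/2}\int_N f(au)\,du$$ be its Satake transform. Let $\mathcal H$ be the Hecke algebra of compactly supported $C$-bi-invariant functions $f:G\to\mathbb C$, and let $$f_0(x)=\mathbf 1_{M(\mathcal O)}(x)\,|\det x|^{\frac{n-1}{2}}\qquad (x\in G).$$ Then $Sf_0$ is defined (the integral converges absolutely) on $A$ and equals the indicator function of $A\cap M(\mathcal O)$.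 Moreover, let $\pi$ be a class one irreducible admissible Hilbert representation of $G$, that is, a continuous, topologically irreducible (not necessarily unitary) representation on a complex Hilbert space $V$ such that $V^U$ is finite dimensional for every open subgroup $U$ of $G$ and $V^{C}\neq 0$. Let $\alpha_1,\dots,\alpha_n\in\mathbb C^\times$ be its Satake parameters: every $f\in\mathcal H$ acts on $V^{C}$ through $\pi(f)=\int_G f(x)\pi(x)\,dx$ as the scalar $$\sum_{m\in\mathbb Z^n} Sf\big(\mathrm{diag}(\varpi^{m_1},\dots,\varpi^{m_n})\big)\,\alpha_1^{m_1}\cdots\alpha_n^{m_n}.$$ Let $\chi_\pi=\mathrm{diag}(\alpha_1,\dots,\alpha_n)$, $|\pi|=\max_j|\alpha_j|$ and $L(\pi)=\det(1-\chi_\pi)^{-1}=\prod_j(1-\alpha_j)^{-1}$. If $|\pi|<1$, then $\pi(f_0)$ exists, in the sense that the sum $$\pi(f_0)=\sum_{D\in C\backslash G/C}\pi(f_0\mathbf 1_D)$$ of operators attached to elements of $\mathcal H$ converges unconditionally in the operator norm; $\pi(f_0)$ is of trace class, and $$\mathrm{tr}\,\pi(f_0)=L(\pi).$$ -/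

import Mathlib

open MeasureTheory ValuativeRel
open scoped NNReal MatrixGroups

namespace LocalGL

section Field

variable (K : Type*) [Field K] [ValuativeRel K] [TopologicalSpace K]
  [IsNonarchimedeanLocalField K]

/-- `q`, the number of elements of the residue class field of `K`. -/
noncomputable def residueCard : ℕ :=
  Nat.card (IsLocalRing.ResidueField (valuation K).integer)

lemma residueCard_ne_zero : (residueCard K : ℝ≥0) ≠ 0 := by
  have : Finite (IsLocalRing.ResidueField (valuation K).integer) := inferInstance
  have h : residueCard K ≠ 0 := Nat.card_pos.ne'
  exact_mod_cast h

variable {K}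

/-- The absolute value on `K`, normalized so that a uniformizer has absolute value `q⁻¹`. The value
group with zero of `K` is identified with `ℤᵐ⁰` by the unique ordered isomorphism, and `ℤᵐ⁰` is
embedded in the nonnegative reals by `exp m ↦ q ^ m`, `0 ↦ 0`. -/
noncomputable def absK (x : K) : ℝ :=
  (WithZeroMulInt.toNNReal (residueCard_ne_zero K)
    (IsNonarchimedeanLocalField.valueGroupWithZeroIsoInt K (valuation K x)) : ℝ≥0)

end Field

section Groups

variable (n : ℕ) (K : Type*) [Field K]

/-- The maximal compact subgroup `GL_n(𝒪)` of `GL_n(K)`. -/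
noncomputable def maxCompact [ValuativeRel K] : Subgroup (GL (Fin n) K) :=
  (Matrix.GeneralLinearGroup.map (n := Fin n) (valuation K).integer.subtype).range

/-- `M(𝒪)`: the `n × n` matrices with entries in the ring of integers. -/
def integralMatrices [ValuativeRel K] : Set (Matrix (Fin n) (Fin n) K) :=
  {x | ∀ i j, x i j ∈ (valuation K).integer}

lemma utri_mul {n : ℕ} {K : Type*} [Field K] {a b : Matrix (Fin n) (Fin n) K}
    (ha : ∀ i j, j < i → a i j = 0) (ha' : ∀ i, a i i = 1)
    (hb : ∀ i j, j < i → b i j = 0) :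
    (∀ i j, j < i → (a * b) i j = 0) ∧ ∀ i, (a * b) i i = b i i := by
  refine ⟨fun i j hij => ?_, fun i => ?_⟩
  · rw [Matrix.mul_apply]
    refine Finset.sum_eq_zero fun k _ => ?_
    rcases lt_or_ge k i with h | h
    · rw [ha i k h, zero_mul]
    · rw [hb k j (hij.trans_le h), mul_zero]
  · rw [Matrix.mul_apply, Finset.sum_eq_single i, ha' i, one_mul]
    · intro k _ hk
      rcases lt_or_gt_of_ne hk with h | h
      · rw [ha i k h, zero_mul]
      · rw [hb k i h, mul_zero]
    · simp
/-- `N`: the subgroup of upper triangular matrices with ones on the diagonal. -/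
def unipotent : Subgroup (GL (Fin n) K) where
  carrier := {g | (∀ i j, j < i → (g : Matrix (Fin n) (Fin n) K) i j = 0) ∧
    ∀ i, (g : Matrix (Fin n) (Fin n) K) i i = 1}
  one_mem' := ⟨fun i j h => by simp [h.ne'], fun i => by simp⟩
  mul_mem' := by
    rintro a b ⟨ha, ha'⟩ ⟨hb, hb'⟩
    obtain ⟨h, h'⟩ := utri_mul ha ha' hb
    exact ⟨h, fun i => (h' i).trans (hb' i)⟩
  inv_mem' := by
    rintro a ⟨ha, ha'⟩
    have hinv : ∀ i j, j < i → ((a⁻¹ : GL (Fin n) K) : Matrix (Fin n) (Fin n) K) i j = 0 := by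
      have : Invertible (a : Matrix (Fin n) (Fin n) K) := a.invertible
      have h := Matrix.blockTriangular_inv_of_blockTriangular
        (M := (a : Matrix (Fin n) (Fin n) K)) (b := id) (fun i j h => ha i j h)
      intro i j hij
      rw [Matrix.coe_units_inv]
      exact h hij
    refine ⟨hinv, fun i => ?_⟩
    rw [← (utri_mul ha ha' hinv).2 i, ← Units.val_mul, mul_inv_cancel]
    simp

variable {n K}

/-- The diagonal matrix `diag(a_1, …, a_n)` as an element of `GL_n(K)`; these form `A`. -/
noncomputable def torus (a : Fin n → Kˣ) : GL (Fin n) K :=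
  Units.map (Matrix.diagonalRingHom (Fin n) K).toMonoidHom (MulEquiv.piUnits.symm a)

end Groups

section Hecke

variable {n : ℕ} {K : Type*} [Field K] [ValuativeRel K] [TopologicalSpace K]

/-- The Hecke algebra as a set: the compactly supported functions on `GL_n(K)` which are
bi-invariant under `GL_n(𝒪)`. -/
def heckeAlgebra (n : ℕ) (K : Type*) [Field K] [ValuativeRel K] [TopologicalSpace K] :
    Set (GL (Fin n) K → ℂ) :=
  {f | HasCompactSupport f ∧ ∀ k ∈ maxCompact n K, ∀ x, f (x * k) = f x ∧ f (k * x) = f x}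

variable [IsNonarchimedeanLocalField K] [MeasurableSpace (GL (Fin n) K)]

/-- The modulus `δ(a) = |a_1|^(n-1) |a_2|^(n-3) ⋯ |a_n|^(-(n-1))` of the Borel subgroup. -/
noncomputable def modulus (a : Fin n → Kˣ) : ℝ :=
  ∏ j : Fin n, absK (a j : K) ^ ((n : ℤ) - 1 - 2 * (j : ℤ))

/-- The Satake transform `Sf(a) = δ(a)^(1/2) ∫_N f(an) dn`, where `dn` is the measure `ν`. -/
noncomputable def satake (ν : Measure (unipotent n K)) (f : GL (Fin n) K → ℂ)
    (a : Fin n → Kˣ) : ℂ :=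
  (Real.sqrt (modulus a) : ℂ) * ∫ u : unipotent n K, f (torus a * (u : GL (Fin n) K)) ∂ν

/-- The function `1_{M(𝒪)}(x) |det x|^((n-1)/2)` on `GL_n(K)`. -/
noncomputable def testFunction (n : ℕ) (K : Type*) [Field K] [ValuativeRel K]
    [TopologicalSpace K] [IsNonarchimedeanLocalField K] (x : GL (Fin n) K) : ℂ :=
  open Classical in
  if (x : Matrix (Fin n) (Fin n) K) ∈ integralMatrices n K then
    ((absK (x : Matrix (Fin n) (Fin n) K).det ^ (((n : ℝ) - 1) / 2) : ℝ) : ℂ)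
  else 0

end Hecke

section Representation

variable {G : Type*} [Group G] {V : Type*} [NormedAddCommGroup V] [InnerProductSpace ℂ V]

/-- The space `V^U` of vectors fixed by every element of `U`. -/
def fixedVectors (π : G →* (V →L[ℂ] V)) (U : Subgroup G) : Submodule ℂ V where
  carrier := {v | ∀ u ∈ U, π u v = v}
  add_mem' := fun ha hb u hu => by rw [map_add, ha u hu, hb u hu]
  zero_mem' := fun u _ => map_zero (π u)
  smul_mem' := fun c v hv u hu => by rw [map_smul, hv u hu]

/-- Irreducible admissible Hilbert representations of a topological group `G`: continuous,
topologically irreducible, with `V^U` finite dimensional for every open subgroup `U`. No unitarity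
is required. -/
structure IsIrreducibleAdmissible [TopologicalSpace G] (π : G →* (V →L[ℂ] V)) : Prop where
  continuous : Continuous fun p : G × V => π p.1 p.2
  nontrivial : Nontrivial V
  irreducible : ∀ W : Submodule ℂ V, IsClosed (W : Set V) →
    (∀ g, ∀ w ∈ W, π g w ∈ W) → W = ⊥ ∨ W = ⊤
  admissible : ∀ U : Subgroup G, IsOpen (U : Set G) → FiniteDimensional ℂ (fixedVectors π U)

/-- `T` is the operator `π(f) = ∫ f(x) π(x) dx`, given by convergent integrals on vectors. -/
def IsIntegralOperator [MeasurableSpace G] (μ : Measure G) (π : G →* (V →L[ℂ] V)) (f : G → ℂ)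
    (T : V →L[ℂ] V) : Prop :=
  ∀ v, Integrable (fun x => f x • π x v) μ ∧ T v = ∫ x, f x • π x v ∂μ

/-- `π(f)` exists and equals `T`, for a function `f` which is bi-invariant under a compact open
subgroup `C` but need not be compactly supported. Such an `f` is the sum of its restrictions `f_D`
to the double cosets `D ∈ C \ G / C`, which are compactly supported and bi-invariant, and
`π(f) = T` means that all the `π(f_D)` exist and that `T` is their (unconditional) sum in the
operator norm. -/
def HasOperatorSum [MeasurableSpace G] (C : Subgroup G) (μ : Measure G) (π : G →* (V →L[ℂ] V))
    (f : G → ℂ) (T : V →L[ℂ] V) : Prop :=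
  ∃ S : DoubleCoset.Quotient (C : Set G) (C : Set G) → (V →L[ℂ] V),
    (∀ D, IsIntegralOperator μ π ((DoubleCoset.quotToDoubleCoset C C D).indicator f) (S D)) ∧
    HasSum S T

end Representation

section TraceClass

variable {V : Type*} [NormedAddCommGroup V] [InnerProductSpace ℂ V] [CompleteSpace V]

/-- `T` is of trace class: `∑ ⟨e_i, |T| e_i⟩ < ∞` for every orthonormal basis `(e_i)`, where
`|T| = (T* T)^(1/2)`. Orthonormal bases are indexed here, without loss of generality, by subsets of
`V`. -/
def IsTraceClass (T : V →L[ℂ] V) : Prop :=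
  ∀ (w : Set V) (b : HilbertBasis w ℂ V), Summable fun i => inner ℂ (b i) (CFC.abs T (b i))

/-- `T` has trace `c`: `∑ ⟨e_i, T e_i⟩ = c`, with convergence, for every orthonormal basis
`(e_i)`. -/
def HasTrace (T : V →L[ℂ] V) (c : ℂ) : Prop :=
  ∀ (w : Set V) (b : HilbertBasis w ℂ V), HasSum (fun i => inner ℂ (b i) (T (b i))) c

end TraceClass

section LFactor

variable {n : ℕ} {K : Type*} [Field K] [ValuativeRel K] [TopologicalSpace K]
  [IsNonarchimedeanLocalField K] [MeasurableSpace (GL (Fin n) K)]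
  {V : Type*} [NormedAddCommGroup V] [InnerProductSpace ℂ V]

/-- `α = (α_1, …, α_n)` represents `χ_π`. Let `lam = A / (A ∩ GL_n(𝒪))`, a free abelian group on
the classes of `ϖ_j = diag(1, …, ϖ, …, 1)`, and let `χ` be the character of `lam` with
`χ(ϖ_j) = α_j`. The condition is that every `f` in the Hecke algebra acts on `V^{GL_n(𝒪)}` by the
scalar `∑_{a ∈ lam} Sf(a) χ(a)`, where `lam` is parametrized by
`m ↦ diag(ϖ^{m_1}, …, ϖ^{m_n})`; the sum has only finitely many nonzero terms. -/
def IsSatakeParameter (μ : Measure (GL (Fin n) K)) (ν : Measure (unipotent n K)) (ϖ : Kˣ)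
    (π : GL (Fin n) K →* (V →L[ℂ] V)) (α : Fin n → ℂˣ) : Prop :=
  ∀ f ∈ heckeAlgebra n K, ∀ v ∈ fixedVectors π (maxCompact n K),
    ∫ x, f x • π x v ∂μ =
      (∑' m : Fin n → ℤ, satake ν f (fun j => ϖ ^ m j) * ∏ j, ((α j ^ m j : ℂˣ) : ℂ)) • v

/-- `|π| = max_j |χ_π(ϖ_j)|`. -/
noncomputable def satakeAbs (α : Fin n → ℂˣ) : ℝ := ⨆ j, ‖(α j : ℂ)‖

/-- `L(π) = det(1 - χ_π)⁻¹`, with `χ_π` regarded as an element of the diagonal torus of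
`GL_n(ℂ)`. -/
noncomputable def localLFactor (α : Fin n → ℂˣ) : ℂ :=
  (1 - Matrix.diagonal fun j => (α j : ℂ)).det⁻¹

end LFactor

end LocalGL

/-! For `a` in `A` and `u` in `N`, the product `au` is integral exactly when all `a_i` are integral
and `a_i u_{ij}` is integral for `i < j`. So `Sf_0(a)` is `δ(a)^{1/2} |det a|^{(n-1)/2}` times the
volume of a box in `N`. With rows numbered from 0, that volume is the product of the
`|a_i|^{-(n-1-i)}`, and all powers of `|a_i|` cancel (`sqrt_modulus_mul`). The volume
(`unipotentBox_measure`) is found by coset counting: relaxing one entry from `𝒪` to `c⁻¹𝒪` replaces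
a box by `|𝒪/c𝒪|` disjoint left translates, so only left invariance and the volume of `N ∩ C` enter.

On the representation side, averaging over `C` gives a projection `P` onto `V^C`
(`exists_projection`). The Hecke algebra acts on `V^C` by scalars, and irreducibility then forces
`V^C` to be a line (`projection_mem_span`). Hence `P` has rank one and trace one, and each `π(f_0
1_D)` is a scalar multiple of `P`.

It remains to sum the scalars `∑_m S(f_0 1_D)(m) α^m` over `D` (`hasSum_scalars`). Since `f_0 ≥ 0`,
the numbers `S(f_0 1_D)(m)` are nonnegative, and for fixed `m` they add up to `Sf_0(m)`, the
indicator of the cone `m ≥ 0`. The double series is therefore dominated by a product of geometric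
series in the `|α_j| < 1`. Interchanging the sums gives `∏ (1 - α_j)⁻¹ = L(π)`, so `π(f_0) = L(π)
P`. -/

namespace LocalGL

/-! ### The normalized absolute value and indices of ideals -/

section Field

variable {K : Type*} [Field K] [ValuativeRel K] [TopologicalSpace K]
  [IsNonarchimedeanLocalField K]

variable (K) in
lemma one_lt_residueCard : 1 < residueCard K := by
  have : Finite (IsLocalRing.ResidueField (valuation K).integer) := inferInstance
  exact Finite.one_lt_card

variable (K) in
lemma residueCard_pos : (0 : ℝ) < residueCard K := by
  exact_mod_cast (zero_lt_one.trans (one_lt_residueCard K))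

lemma absK_mul (x y : K) : absK (x * y) = absK x * absK y := by simp [absK]

@[simp] lemma absK_one : absK (1 : K) = 1 := by simp [absK]

lemma absK_prod {ι : Type*} (s : Finset ι) (x : ι → K) :
    absK (∏ i ∈ s, x i) = ∏ i ∈ s, absK (x i) := by simp [absK]

lemma absK_pow (x : K) (m : ℕ) : absK (x ^ m) = absK x ^ m := by simp [absK]

lemma absK_zpow (x : K) (m : ℤ) : absK (x ^ m) = absK x ^ m := by simp [absK]

lemma absK_nonneg (x : K) : 0 ≤ absK x := NNReal.coe_nonneg _

lemma absK_pos {x : K} (hx : x ≠ 0) : 0 < absK x := by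
  refine (absK_nonneg x).lt_of_ne' ?_
  simp [absK, hx]

lemma absK_le_iff {x y : K} : absK x ≤ absK y ↔ valuation K x ≤ valuation K y := by
  have hq : (1 : ℝ≥0) < residueCard K := by exact_mod_cast one_lt_residueCard K
  rw [absK, absK, NNReal.coe_le_coe]
  erw [(WithZeroMulInt.toNNReal_strictMono hq).le_iff_le]
  exact map_le_map_iff (IsNonarchimedeanLocalField.valueGroupWithZeroIsoInt K)

lemma absK_le_one_iff {x : K} : absK x ≤ 1 ↔ x ∈ (valuation K).integer := by
  rw [← absK_one (K := K), absK_le_iff, map_one, Valuation.mem_integer_iff]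

lemma exists_absK_eq_zpow {x : K} (hx : x ≠ 0) : ∃ m : ℤ, absK x = (residueCard K : ℝ) ^ m := by
  have hx' : IsNonarchimedeanLocalField.valueGroupWithZeroIsoInt K (valuation K x) ≠ 0 := by
    simpa using hx
  refine ⟨(WithZero.unzero hx').toAdd, ?_⟩
  rw [absK, WithZeroMulInt.toNNReal_neg_apply _ hx']
  simp

lemma absK_one_lt_iff {x : K} : absK x < 1 ↔ valuation K x < 1 := by
  rw [← not_le, ← not_le, not_iff_not, ← absK_one (K := K), absK_le_iff, map_one]

/-- Nonzero absolute values are integral powers of `q`, so `|x| < 1` already forces `|x| ≤ q⁻¹ =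
|ϖ|`. -/
lemma maximalIdeal_eq_span {ϖ : (valuation K).integer}
    (hϖ : absK (ϖ : K) = (residueCard K : ℝ)⁻¹) :
    IsLocalRing.maximalIdeal (valuation K).integer = Ideal.span {ϖ} := by
  have hq : (1 : ℝ) < residueCard K := by exact_mod_cast one_lt_residueCard K
  have hϖ0 : (ϖ : K) ≠ 0 := by
    intro h
    rw [h] at hϖ
    have := inv_pos.2 (residueCard_pos K)
    simp [absK] at hϖ
    exact (residueCard_pos K).ne' (by simpa using hϖ.symm)
  have key : ∀ x : (valuation K).integer, x ∈ IsLocalRing.maximalIdeal (valuation K).integer ↔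
      absK (x : K) < 1 := by
    intro x
    rw [absK_one_lt_iff, IsLocalRing.mem_maximalIdeal, mem_nonunits_iff,
      Valuation.Integers.isUnit_iff_valuation_eq_one (Valuation.integer.integers _)]
    exact ⟨fun h => lt_of_le_of_ne x.2 h, fun h => h.ne⟩
  apply le_antisymm
  · intro x hx
    rw [Ideal.mem_span_singleton]
    rcases eq_or_ne (x : K) 0 with h0 | h0
    · rw [show x = 0 from Subtype.ext h0]; exact dvd_zero _
    · obtain ⟨m, hm⟩ := exists_absK_eq_zpow h0
      have h1 := (key x).1 hx
      rw [hm] at h1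
      have hm0 : m < 0 := by
        by_contra h
        exact absurd (one_le_zpow₀ hq.le (not_lt.1 h)) (not_le.2 h1)
      have hmem : (x : K) * (ϖ : K)⁻¹ ∈ (valuation K).integer := by
        rw [← absK_le_one_iff, absK_mul, hm, ← zpow_neg_one (ϖ : K), absK_zpow, hϖ, zpow_neg_one,
          inv_inv, ← zpow_add_one₀ (residueCard_pos K).ne']
        exact zpow_le_one_of_nonpos₀ hq.le (by omega)
      refine ⟨⟨_, hmem⟩, Subtype.ext ?_⟩
      push_cast
      field_simp
  · rw [Ideal.span_singleton_le_iff_mem, key, hϖ]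
    exact inv_lt_one_of_one_lt₀ hq

/-- If `|b| = q⁻ᵏ`, then `b` generates the `k`-th power of the maximal ideal, which has index `q ^
k`. This converts the coset counts in `N` into absolute values. -/
lemma card_quotient_span {ϖ : K} (hϖ : absK ϖ = (residueCard K : ℝ)⁻¹)
    {b : (valuation K).integer} (hb : b ≠ 0) :
    (Nat.card ((valuation K).integer ⧸ Ideal.span {b}) : ℝ) * absK (b : K) = 1 := by
  have hq : (1 : ℝ) < residueCard K := by exact_mod_cast one_lt_residueCard K
  have hb' : (b : K) ≠ 0 := by simpa using hb
  obtain ⟨m, hm⟩ := exists_absK_eq_zpow hb'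
  have hm0 : m ≤ 0 := by
    by_contra h
    have h1 := absK_le_one_iff.2 b.2
    rw [hm] at h1
    exact absurd (one_lt_zpow₀ hq (not_le.1 h)) (not_lt.2 h1)
  obtain ⟨k, rfl⟩ : ∃ k : ℕ, m = -k := ⟨m.natAbs, by omega⟩
  have hϖmem : ϖ ∈ (valuation K).integer := by
    rw [← absK_le_one_iff, hϖ]; exact inv_le_one_of_one_le₀ hq.le
  let p : (valuation K).integer := ⟨ϖ, hϖmem⟩
  have hp := maximalIdeal_eq_span (ϖ := p) hϖ
  have hϖ0 : ϖ ≠ 0 := by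
    rintro rfl
    simp [absK] at hϖ
    exact (residueCard_pos K).ne' (by simpa using hϖ.symm)
  have hdvd : ∀ x y : (valuation K).integer, y ≠ 0 → absK (x : K) ≤ absK (y : K) → y ∣ x := by
    intro x y hy h
    have hy' : (y : K) ≠ 0 := by simpa using hy
    have hmem : (x : K) * (y : K)⁻¹ ∈ (valuation K).integer := by
      rw [← absK_le_one_iff, absK_mul, ← zpow_neg_one (y : K), absK_zpow, zpow_neg_one,
        ← div_eq_mul_inv]
      exact div_le_one_of_le₀ h (absK_nonneg _)
    refine ⟨⟨_, hmem⟩, Subtype.ext ?_⟩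
    push_cast
    field_simp
  have hpk : absK ((p ^ k : (valuation K).integer) : K) = absK (b : K) := by
    push_cast
    rw [absK_pow, hm, hϖ, zpow_neg, zpow_natCast, inv_pow]
  have hspan : Ideal.span {b} = IsLocalRing.maximalIdeal (valuation K).integer ^ k := by
    rw [hp, Ideal.span_singleton_pow]
    apply le_antisymm <;> rw [Ideal.span_singleton_le_span_singleton]
    · exact hdvd _ _ (pow_ne_zero _ fun h => hϖ0 (congrArg Subtype.val h)) hpk.ge
    · exact hdvd _ _ hb hpk.le
  have hcard : Nat.card ((valuation K).integer ⧸ Ideal.span {b}) = residueCard K ^ k := by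
    rw [hspan]
    have h0 : IsLocalRing.maximalIdeal (valuation K).integer ≠ ⊥ :=
      IsDiscreteValuationRing.not_a_field _
    have := cardQuot_pow_of_prime h0 (i := k)
    rw [Submodule.cardQuot_apply, Submodule.cardQuot_apply] at this
    exact this
  rw [hcard, hm, zpow_neg, zpow_natCast, Nat.cast_pow, mul_inv_cancel₀]
  exact pow_ne_zero _ (residueCard_pos K).ne'

lemma finite_quotient_span {ϖ : K} (hϖ : absK ϖ = (residueCard K : ℝ)⁻¹)
    {b : (valuation K).integer} (hb : b ≠ 0) :
    Finite ((valuation K).integer ⧸ Ideal.span {b}) := by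
  refine Nat.finite_of_card_ne_zero fun h => ?_
  simpa [h] using card_quotient_span hϖ hb

variable (K) in
lemma isOpen_integer : IsOpen ((valuation K).integer : Set K) :=
  Valuation.isOpen_integer

variable (K) in
lemma isCompact_integer : IsCompact ((valuation K).integer : Set K) :=
  IsNonarchimedeanLocalField.isCompact_closedBall K 1

variable (K) in
lemma t2Space_of_localField : T2Space K := by
  let := IsTopologicalAddGroup.rightUniformSpace K
  have := isUniformAddGroup_of_addCommGroup (G := K)
  have : T0Space K := ValuedRing.separated
  infer_instance

end Field

/-! ### The maximal compact subgroup and the test function -/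

section MaxCompact

variable {n : ℕ} {K : Type*} [Field K] [ValuativeRel K]

lemma mul_mem_integralMatrices {x y : Matrix (Fin n) (Fin n) K}
    (hx : x ∈ integralMatrices n K) (hy : y ∈ integralMatrices n K) :
    x * y ∈ integralMatrices n K := fun i j => by
  rw [Matrix.mul_apply]
  exact sum_mem fun k _ => mul_mem (hx i k) (hy k j)

/-- Integral entries of `g` and `g⁻¹` lift to matrices over `𝒪`, which remain mutually inverse
because entrywise inclusion into `K` is injective. -/
lemma mem_maxCompact_iff {g : GL (Fin n) K} :
    g ∈ maxCompact n K ↔ (g : Matrix (Fin n) (Fin n) K) ∈ integralMatrices n K ∧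
      ((g⁻¹ : GL (Fin n) K) : Matrix (Fin n) (Fin n) K) ∈ integralMatrices n K := by
  constructor
  · rintro ⟨h, rfl⟩
    refine ⟨fun i j => ?_, fun i j => ?_⟩
    · exact ((h : Matrix (Fin n) (Fin n) (valuation K).integer) i j).2
    · rw [← map_inv]
      exact (((h⁻¹ : GL (Fin n) (valuation K).integer) :
        Matrix (Fin n) (Fin n) (valuation K).integer) i j).2
  · rintro ⟨h1, h2⟩
    have hinj : Function.Injective
        ((valuation K).integer.subtype.mapMatrix : Matrix (Fin n) (Fin n) _ →+* _) :=
      Matrix.map_injective Subtype.val_injective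
    let A : Matrix (Fin n) (Fin n) (valuation K).integer := Matrix.of fun i j => ⟨_, h1 i j⟩
    let B : Matrix (Fin n) (Fin n) (valuation K).integer := Matrix.of fun i j => ⟨_, h2 i j⟩
    have hA : (valuation K).integer.subtype.mapMatrix A = g := by ext i j; rfl
    have hB : (valuation K).integer.subtype.mapMatrix B = (g⁻¹ : GL (Fin n) K) := by ext i j; rfl
    refine ⟨⟨A, B, hinj ?_, hinj ?_⟩, Units.ext hA⟩
    · rw [map_mul, hA, hB, map_one, ← Units.val_mul, mul_inv_cancel, Units.val_one]
    · rw [map_mul, hA, hB, map_one, ← Units.val_mul, inv_mul_cancel, Units.val_one]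

lemma mul_mem_integralMatrices_iff_right {x : Matrix (Fin n) (Fin n) K} {k : GL (Fin n) K}
    (hk : k ∈ maxCompact n K) : x * k ∈ integralMatrices n K ↔ x ∈ integralMatrices n K := by
  refine ⟨fun h => ?_, fun h => mul_mem_integralMatrices h (mem_maxCompact_iff.1 hk).1⟩
  have := mul_mem_integralMatrices h (mem_maxCompact_iff.1 hk).2
  rwa [mul_assoc, ← Units.val_mul, mul_inv_cancel, Units.val_one, mul_one] at this

lemma mul_mem_integralMatrices_iff_left {x : Matrix (Fin n) (Fin n) K} {k : GL (Fin n) K}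
    (hk : k ∈ maxCompact n K) : (k : Matrix (Fin n) (Fin n) K) * x ∈ integralMatrices n K ↔
      x ∈ integralMatrices n K := by
  refine ⟨fun h => ?_, fun h => mul_mem_integralMatrices (mem_maxCompact_iff.1 hk).1 h⟩
  have := mul_mem_integralMatrices (mem_maxCompact_iff.1 hk).2 h
  rwa [← mul_assoc, ← Units.val_mul, inv_mul_cancel, Units.val_one, one_mul] at this

-- The unit group carries the topology induced by `Units.embedProduct`, so openness and compactness
-- of `C` reduce to those of `M(𝒪)`.
variable (n K) in
lemma maxCompact_eq_preimage : (maxCompact n K : Set (GL (Fin n) K)) =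
    Units.embedProduct _ ⁻¹'
      (integralMatrices n K ×ˢ (MulOpposite.unop ⁻¹' integralMatrices n K)) := by
  ext g
  rw [SetLike.mem_coe, mem_maxCompact_iff]
  rfl

lemma det_mem_integer {x : Matrix (Fin n) (Fin n) K} (hx : x ∈ integralMatrices n K) :
    x.det ∈ (valuation K).integer := by
  rw [Matrix.det_apply]
  refine sum_mem fun σ _ => ?_
  rw [Units.smul_def]
  exact zsmul_mem (prod_mem fun i _ => hx _ _) _

variable [TopologicalSpace K] [IsNonarchimedeanLocalField K]

variable (n K) in
lemma isOpen_integralMatrices : IsOpen (integralMatrices n K) := by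
  simp only [integralMatrices, Set.ofPred_forall]
  refine isOpen_iInter_of_finite fun i => isOpen_iInter_of_finite fun j => ?_
  exact (isOpen_integer K).preimage (continuous_id.matrix_elem i j)

variable (n K) in
lemma isCompact_integralMatrices : IsCompact (integralMatrices n K) := by
  have h := isCompact_univ_pi fun _ : Fin n => isCompact_univ_pi fun _ : Fin n =>
    isCompact_integer K
  have e : integralMatrices n K = (Set.pi Set.univ fun _ => Set.pi Set.univ fun _ =>
      ((valuation K).integer : Set K) : Set (Fin n → Fin n → K)) :=
    Set.ext fun x => ⟨fun h i _ j _ => h i j, fun h i j => h i trivial j trivial⟩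
  rw [e]
  exact h

variable (n K) in
lemma isOpen_maxCompact : IsOpen (maxCompact n K : Set (GL (Fin n) K)) := by
  rw [maxCompact_eq_preimage]
  exact ((isOpen_integralMatrices n K).prod
    ((isOpen_integralMatrices n K).preimage MulOpposite.continuous_unop)).preimage
    Units.continuous_embedProduct

variable (n K) in
lemma isCompact_maxCompact : IsCompact (maxCompact n K : Set (GL (Fin n) K)) := by
  have := t2Space_of_localField K
  rw [maxCompact_eq_preimage]
  refine Units.isClosedEmbedding_embedProduct.isCompact_preimage
    ((isCompact_integralMatrices n K).prod ?_)
  exact MulOpposite.opHomeomorph.symm.isClosedEmbedding.isCompact_preimage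
    (isCompact_integralMatrices n K)

variable (n K) in
lemma locallyCompactSpace_GL : LocallyCompactSpace (GL (Fin n) K) := by
  have := t2Space_of_localField K
  have : LocallyCompactSpace (Matrix (Fin n) (Fin n) K) :=
    inferInstanceAs (LocallyCompactSpace (Fin n → Fin n → K))
  infer_instance

lemma absK_det_of_mem_maxCompact {k : GL (Fin n) K} (hk : k ∈ maxCompact n K) :
    absK (k : Matrix (Fin n) (Fin n) K).det = 1 := by
  obtain ⟨h1, h2⟩ := mem_maxCompact_iff.1 hk
  have h1 := absK_le_one_iff.2 (det_mem_integer h1)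
  have h2 := absK_le_one_iff.2 (det_mem_integer h2)
  have h3 : absK (k : Matrix (Fin n) (Fin n) K).det *
      absK ((k⁻¹ : GL (Fin n) K) : Matrix (Fin n) (Fin n) K).det = 1 := by
    rw [← absK_mul, ← Matrix.det_mul, ← Units.val_mul, mul_inv_cancel]
    simp
  nlinarith [absK_nonneg (k : Matrix (Fin n) (Fin n) K).det]

lemma testFunction_of_mem {x : GL (Fin n) K}
    (hx : (x : Matrix (Fin n) (Fin n) K) ∈ integralMatrices n K) :
    testFunction n K x =
      ((absK (x : Matrix (Fin n) (Fin n) K).det ^ (((n : ℝ) - 1) / 2) : ℝ) : ℂ) :=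
  if_pos hx

lemma testFunction_of_notMem {x : GL (Fin n) K}
    (hx : (x : Matrix (Fin n) (Fin n) K) ∉ integralMatrices n K) :
    testFunction n K x = 0 :=
  if_neg hx

lemma testFunction_mul_right {k : GL (Fin n) K} (hk : k ∈ maxCompact n K) (x : GL (Fin n) K) :
    testFunction n K (x * k) = testFunction n K x := by
  have h := mul_mem_integralMatrices_iff_right (x := (x : Matrix (Fin n) (Fin n) K)) hk
  by_cases hx : (x : Matrix (Fin n) (Fin n) K) ∈ integralMatrices n K
  · rw [testFunction_of_mem hx, testFunction_of_mem (h.2 hx), Units.val_mul, Matrix.det_mul,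
      absK_mul, absK_det_of_mem_maxCompact hk, mul_one]
  · rw [testFunction_of_notMem hx, testFunction_of_notMem (mt h.1 hx)]

lemma testFunction_mul_left {k : GL (Fin n) K} (hk : k ∈ maxCompact n K) (x : GL (Fin n) K) :
    testFunction n K (k * x) = testFunction n K x := by
  have h := mul_mem_integralMatrices_iff_left (x := (x : Matrix (Fin n) (Fin n) K)) hk
  by_cases hx : (x : Matrix (Fin n) (Fin n) K) ∈ integralMatrices n K
  · rw [testFunction_of_mem hx, testFunction_of_mem (h.2 hx), Units.val_mul, Matrix.det_mul,
      absK_mul, absK_det_of_mem_maxCompact hk, one_mul]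
  · rw [testFunction_of_notMem hx, testFunction_of_notMem (mt h.1 hx)]

end MaxCompact

/-! ### Topology of double cosets -/

section DoubleCosets

variable {G : Type*} [Group G] {C : Subgroup G}

lemma mul_mem_quotToDoubleCoset_right {k : G} (hk : k ∈ C) (x : G)
    (D : DoubleCoset.Quotient (C : Set G) (C : Set G)) :
    x * k ∈ DoubleCoset.quotToDoubleCoset C C D ↔ x ∈ DoubleCoset.quotToDoubleCoset C C D := by
  rw [DoubleCoset.mem_quotToDoubleCoset_iff, DoubleCoset.mem_quotToDoubleCoset_iff,
    (DoubleCoset.eq C C x (x * k)).2 ⟨1, one_mem _, k, hk, by simp⟩]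

lemma mul_mem_quotToDoubleCoset_left {k : G} (hk : k ∈ C) (x : G)
    (D : DoubleCoset.Quotient (C : Set G) (C : Set G)) :
    k * x ∈ DoubleCoset.quotToDoubleCoset C C D ↔ x ∈ DoubleCoset.quotToDoubleCoset C C D := by
  rw [DoubleCoset.mem_quotToDoubleCoset_iff, DoubleCoset.mem_quotToDoubleCoset_iff,
    (DoubleCoset.eq C C x (k * x)).2 ⟨k, hk, 1, one_mem _, by simp⟩]

variable [TopologicalSpace G] [IsTopologicalGroup G]

lemma isOpen_quotToDoubleCoset (hC : IsOpen (C : Set G))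
    (D : DoubleCoset.Quotient (C : Set G) (C : Set G)) :
    IsOpen (DoubleCoset.quotToDoubleCoset C C D) :=
  IsOpen.mul_left hC

lemma isCompact_quotToDoubleCoset (hC : IsCompact (C : Set G))
    (D : DoubleCoset.Quotient (C : Set G) (C : Set G)) :
    IsCompact (DoubleCoset.quotToDoubleCoset C C D) :=
  (hC.mul isCompact_singleton).mul hC

/-- Such a function is constant on each open coset `xC`, hence locally constant. -/
lemma continuous_of_forall_mul_eq {X : Type*} [TopologicalSpace X] (hC : IsOpen (C : Set G))
    {f : G → X} (hf : ∀ k ∈ C, ∀ x, f (x * k) = f x) : Continuous f := by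
  refine IsLocallyConstant.continuous ((IsLocallyConstant.iff_exists_open f).2 fun x => ?_)
  refine ⟨(x * ·) '' (C : Set G), isOpenMap_mul_left x _ hC, ⟨1, one_mem C, by simp⟩, ?_⟩
  rintro _ ⟨k, hk, rfl⟩
  exact hf k hk x

end DoubleCosets

/-! ### Right translation of Haar measure by a compact open subgroup -/

section RightInvariance

variable {G : Type*} [Group G] [TopologicalSpace G] [IsTopologicalGroup G]
  [LocallyCompactSpace G] [MeasurableSpace G] [BorelSpace G] {μ : Measure G} [μ.IsHaarMeasure]
  {C : Subgroup G} {E : Type*} [NormedAddCommGroup E] [NormedSpace ℝ E]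

/-- A Haar measure is invariant under right translation by the elements of a compact open
subgroup, at least on compact sets. -/
lemma integral_mul_right_eq_of_mem (hC : IsOpen (C : Set G)) (hC' : IsCompact (C : Set G))
    {c : G} (hc : c ∈ C) {D : Set G} (hD : IsCompact D) {F : G → E}
    (hF : ∀ x ∉ D, F x = 0) : ∫ x, F (x * c) ∂μ = ∫ x, F x ∂μ := by
  let μ' := μ.map (Homeomorph.mulRight c)
  have hfin : IsFiniteMeasureOnCompacts μ' := by
    refine ⟨fun S hS => ?_⟩
    rw [(Homeomorph.mulRight c).measurableEmbedding.map_apply]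
    exact ((Homeomorph.mulRight c).isCompact_preimage.2 hS).measure_lt_top
  have hinv : μ'.IsMulLeftInvariant := by
    refine ⟨fun g => ?_⟩
    have hm : Measurable (g * · : G → G) := (continuous_const_mul g).measurable
    have hm' : Measurable (Homeomorph.mulRight c) := (Homeomorph.mulRight c).continuous.measurable
    have h : (g * ·) ∘ (Homeomorph.mulRight c) = (Homeomorph.mulRight c) ∘ (g * ·) := by
      ext x; simp [mul_assoc]
    rw [Measure.map_map hm hm', h, ← Measure.map_map hm' hm, map_mul_left_eq_self]
  -- Both measures give `C` the same mass, which is positive and finite, so the proportionality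
  -- factor is 1.
  have hk : Measure.haarScalarFactor μ' μ = 1 := by
    have h := Measure.measure_isMulInvariant_eq_smul_of_isCompact_closure μ' μ (s := C) hC'.closure
    have h' : μ' C = μ C := by
      rw [Measure.map_apply (Homeomorph.mulRight c).continuous.measurable hC.measurableSet]
      congr 1
      ext x
      simp [C.mul_mem_cancel_right hc]
    have h0 : μ C ≠ 0 := (hC.measure_pos μ ⟨1, one_mem C⟩).ne'
    rw [h', ENNReal.smul_def, smul_eq_mul] at h
    exact_mod_cast (ENNReal.mul_left_inj h0 hC'.measure_lt_top.ne).1 (h.symm.trans (one_mul _).symm)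
  -- No regularity of `μ` is assumed: proportionality is used only on sets with compact closure,
  -- hence the restriction to `D`.
  have hres : μ'.restrict D = μ.restrict D := by
    ext s hs
    rw [Measure.restrict_apply hs, Measure.restrict_apply hs,
      Measure.measure_isMulInvariant_eq_smul_of_isCompact_closure μ' μ
        (hD.closure_of_subset Set.inter_subset_right), hk, one_smul]
  calc ∫ x, F (x * c) ∂μ = ∫ x, F x ∂μ' :=
        ((Homeomorph.mulRight c).measurableEmbedding.integral_map F).symm
    _ = ∫ x in D, F x ∂μ' := (setIntegral_eq_integral_of_forall_compl_eq_zero hF).symm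
    _ = ∫ x, F x ∂μ := by rw [hres, setIntegral_eq_integral_of_forall_compl_eq_zero hF]

end RightInvariance

lemma indicator_eq_of_mem_iff {X E : Type*} [Zero E] {S : Set X} {f : X → E} {x y : X}
    (h : y ∈ S ↔ x ∈ S) (hf : f y = f x) : S.indicator f y = S.indicator f x := by
  by_cases hx : x ∈ S
  · rw [Set.indicator_of_mem hx, Set.indicator_of_mem (h.2 hx), hf]
  · rw [Set.indicator_of_notMem hx, Set.indicator_of_notMem (mt h.1 hx)]

/-! ### The operators attached to compactly supported functions -/

section Operators

variable {G : Type*} [Group G] [TopologicalSpace G]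
  {V : Type*} [NormedAddCommGroup V] [InnerProductSpace ℂ V]
  {π : G →* (V →L[ℂ] V)}

/-- Orbit maps are continuous, hence bounded on `S`; Banach–Steinhaus makes these pointwise bounds
uniform. -/
lemma exists_norm_le_of_isCompact [CompleteSpace V]
    (hπ : Continuous fun p : G × V => π p.1 p.2) {S : Set G} (hS : IsCompact S) :
    ∃ M, ∀ g ∈ S, ‖π g‖ ≤ M := by
  obtain ⟨M, hM⟩ := banach_steinhaus (g := fun g : S => π g) fun v => by
    have hc : Continuous fun g : G => π g v := hπ.comp (continuous_id.prodMk continuous_const)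
    obtain ⟨M, hM⟩ := hS.exists_bound_of_continuousOn hc.continuousOn
    exact ⟨M, fun g => hM g g.2⟩
  exact ⟨M, fun g hg => hM ⟨g, hg⟩⟩

variable [MeasurableSpace G] [BorelSpace G] {μ : Measure G}

lemma integrable_smul_apply [IsFiniteMeasureOnCompacts μ]
    (hπ : Continuous fun p : G × V => π p.1 p.2) {f : G → ℂ} (hf : Continuous f)
    (hf' : HasCompactSupport f) (v : V) : Integrable (fun x => f x • π x v) μ := by
  have hc : Continuous fun g : G => π g v := hπ.comp (continuous_id.prodMk continuous_const)
  exact (hf.smul hc).integrable_of_hasCompactSupport hf'.smul_right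

lemma exists_isIntegralOperator [CompleteSpace V] [IsFiniteMeasureOnCompacts μ]
    (hπ : Continuous fun p : G × V => π p.1 p.2) {f : G → ℂ} (hf : Continuous f)
    (hf' : HasCompactSupport f) : ∃ T, IsIntegralOperator μ π f T := by
  have hint := integrable_smul_apply (μ := μ) hπ hf hf'
  obtain ⟨M, hM⟩ := exists_norm_le_of_isCompact hπ hf'
  let L : V →ₗ[ℂ] V :=
    { toFun := fun v => ∫ x, f x • π x v ∂μ
      map_add' := fun v w => by
        simp only [map_add, smul_add]
        exact integral_add (hint v) (hint w)
      map_smul' := fun c v => by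
        simp only [map_smul, RingHom.id_apply]
        rw [← integral_smul]
        simp only [smul_comm c] }
  refine ⟨L.mkContinuous ((∫ x, ‖f x‖ ∂μ) * M) fun v => ?_, fun v => ⟨hint v, rfl⟩⟩
  have hfi : Integrable f μ := hf.integrable_of_hasCompactSupport hf'
  have : ‖∫ x, f x • π x v ∂μ‖ ≤ ∫ x, ‖f x‖ * (M * ‖v‖) ∂μ := by
    refine norm_integral_le_of_norm_le (hfi.norm.mul_const _) (.of_forall fun x => ?_)
    rw [norm_smul]
    by_cases hx : x ∈ tsupport f
    · exact mul_le_mul_of_nonneg_left (((π x).le_opNorm v).trans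
        (mul_le_mul_of_nonneg_right (hM x hx) (norm_nonneg v))) (norm_nonneg _)
    · simp [image_eq_zero_of_notMem_tsupport hx]
  rw [integral_mul_const] at this
  simpa [L, mul_assoc] using this

lemma apply_eq_of_left_invariant [CompleteSpace V] [IsTopologicalGroup G] [μ.IsMulLeftInvariant] {f : G → ℂ}
    {T : V →L[ℂ] V} (hT : IsIntegralOperator μ π f T) {c : G} (hf : ∀ x, f (c * x) = f x) (v : V) :
    π c (T v) = T v := by
  rw [(hT v).2, ← ContinuousLinearMap.integral_comp_comm _ (hT v).1,
    ← integral_mul_left_eq_self (fun x => f x • π x v) c]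
  simp only [map_smul, hf, map_mul, mul_apply_eq_comp]

lemma apply_eq_of_right_invariant [IsTopologicalGroup G] [LocallyCompactSpace G]
    [μ.IsHaarMeasure] {C : Subgroup G} (hC : IsOpen (C : Set G)) (hC' : IsCompact (C : Set G))
    {f : G → ℂ} (hfs : HasCompactSupport f) {T : V →L[ℂ] V} (hT : IsIntegralOperator μ π f T)
    {c : G} (hc : c ∈ C) (hf : ∀ x, f (x * c) = f x) (v : V) : T (π c v) = T v := by
  rw [(hT v).2, (hT _).2, ← integral_mul_right_eq_of_mem hC hC' hc hfs
    (F := fun x => f x • π x v)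
    fun x hx => by rw [image_eq_zero_of_notMem_tsupport hx, zero_smul]]
  simp only [hf, map_mul, mul_apply_eq_comp]

end Operators

/-! ### The projection onto the fixed vectors of `C`, and multiplicity one -/

section Projection

variable {G : Type*} [Group G] [TopologicalSpace G] [IsTopologicalGroup G]
  [MeasurableSpace G] [BorelSpace G] {μ : Measure G} [μ.IsHaarMeasure]
  {C : Subgroup G} {V : Type*} [NormedAddCommGroup V] [InnerProductSpace ℂ V] [CompleteSpace V]
  {π : G →* (V →L[ℂ] V)}

/-- Averaging over a compact open subgroup `C` defines a projection `P` onto `V^C` through which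
every operator `π(f)`, with `f` invariant under `C` on the right, factors. -/
lemma exists_projection [LocallyCompactSpace G]
    (hπ : Continuous fun p : G × V => π p.1 p.2) (hC : IsOpen (C : Set G))
    (hC' : IsCompact (C : Set G)) (hμ : μ C = 1) :
    ∃ P : V →L[ℂ] V, (∀ v, P v ∈ fixedVectors π C) ∧ (∀ v ∈ fixedVectors π C, P v = v) ∧
      (∀ c ∈ C, ∀ v, P (π c v) = P v) ∧
      ∀ (f : G → ℂ) (T : V →L[ℂ] V), HasCompactSupport f → (∀ c ∈ C, ∀ x, f (x * c) = f x) →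
        IsIntegralOperator μ π f T → ∀ v, T (P v) = T v := by
  have hclosed : IsClosed (C : Set G) := C.isClosed_of_isOpen hC
  set e : G → ℂ := (C : Set G).indicator (fun _ => 1) with he
  have hright : ∀ c ∈ C, ∀ x, e (x * c) = e x := fun c hc x =>
    indicator_eq_of_mem_iff (C.mul_mem_cancel_right hc) rfl
  have hleft : ∀ c ∈ C, ∀ x, e (c * x) = e x := fun c hc x =>
    indicator_eq_of_mem_iff (C.mul_mem_cancel_left hc) rfl
  have hsupp : HasCompactSupport e := by
    refine HasCompactSupport.intro' hC' hclosed fun x hx => ?_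
    simp [he, hx]
  -- `P` is the operator of the indicator of `C`, an average because `C` has volume 1.
  obtain ⟨P, hP⟩ := exists_isIntegralOperator (μ := μ) hπ
    (continuous_of_forall_mul_eq hC hright) hsupp
  have hconst : ∀ w : V, ∫ x, e x • w ∂μ = w := fun w => by
    rw [integral_smul_const, he, integral_indicator_const _ hC.measurableSet, Measure.real, hμ]
    simp
  refine ⟨P, fun v c hc => apply_eq_of_left_invariant hP (hleft c hc) v, fun v hv => ?_,
    fun c hc v => apply_eq_of_right_invariant hC hC' hsupp hP hc (hright c hc) v,
    fun f T hf hfC hT v => ?_⟩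
  · rw [(hP v).2]
    refine Eq.trans (congrArg _ (funext fun x => ?_)) (hconst v)
    by_cases hx : x ∈ C
    · rw [hv x hx]
    · simp [he, hx]
  · rw [(hP v).2, ← ContinuousLinearMap.integral_comp_comm _ (hP v).1]
    refine Eq.trans (congrArg _ (funext fun x => ?_)) (hconst (T v))
    rw [map_smul]
    by_cases hx : x ∈ C
    · rw [apply_eq_of_right_invariant hC hC' hf hT hx (hfC x hx)]
    · simp [he, hx]

/-- If the characteristic functions of all double cosets act by scalars on `V^C`, then `V^C` is at
most one dimensional. -/
lemma projection_mem_span (hπ : IsIrreducibleAdmissible π) (hC : IsOpen (C : Set G))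
    (hC' : IsCompact (C : Set G)) {P : V →L[ℂ] V}
    (hP' : ∀ v ∈ fixedVectors π C, P v = v) (hPC : ∀ c ∈ C, ∀ v, P (π c v) = P v)
    (hscal : ∀ D : DoubleCoset.Quotient (C : Set G) (C : Set G), ∃ l : ℂ,
      ∀ v ∈ fixedVectors π C,
        ∫ x, (DoubleCoset.quotToDoubleCoset C C D).indicator (fun _ => (1 : ℂ)) x • π x v ∂μ = l • v)
    {v₀ : V} (hv₀ : v₀ ∈ fixedVectors π C) (hv₀' : v₀ ≠ 0) (v : V) :
    P v ∈ Submodule.span ℂ {v₀} := by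
  -- On `CgC` the vector `P π(x) v₀` is constant: writing `x = agb`, `P` absorbs `a` and `v₀`
  -- absorbs `b`. So `P π(1_{CgC}) v₀` equals both `vol(CgC) P π(g) v₀` and a multiple of `v₀`.
  have hbase : ∀ g, P (π g v₀) ∈ Submodule.span ℂ {v₀} := by
    intro g
    set D := DoubleCoset.mk C C g with hD
    have hgD : g ∈ DoubleCoset.quotToDoubleCoset C C D :=
      (DoubleCoset.mem_quotToDoubleCoset_iff D g).2 rfl
    have hDo := isOpen_quotToDoubleCoset hC D
    have hDc := isCompact_quotToDoubleCoset hC' D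
    set f : G → ℂ := (DoubleCoset.quotToDoubleCoset C C D).indicator (fun _ => (1 : ℂ)) with hf
    have hright : ∀ c ∈ C, ∀ x, f (x * c) = f x := fun c hc x =>
      indicator_eq_of_mem_iff (mul_mem_quotToDoubleCoset_right hc x D) rfl
    have hleft : ∀ c ∈ C, ∀ x, f (c * x) = f x := fun c hc x =>
      indicator_eq_of_mem_iff (mul_mem_quotToDoubleCoset_left hc x D) rfl
    have hfc : Continuous f := continuous_of_forall_mul_eq hC hright
    have hsupp : HasCompactSupport f := by
      refine HasCompactSupport.intro hDc fun x hx => ?_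
      simp [hf, hx]
    obtain ⟨T, hT⟩ := exists_isIntegralOperator (μ := μ) hπ.continuous hfc hsupp
    obtain ⟨l, hl⟩ := hscal D
    have h1 : P (T v₀) = l • v₀ := by
      rw [hP' _ fun c hc => apply_eq_of_left_invariant hT (hleft c hc) v₀, (hT v₀).2]
      exact hl v₀ hv₀
    have h2 : P (T v₀) = (∫ x, f x ∂μ) • P (π g v₀) := by
      rw [(hT v₀).2, ← ContinuousLinearMap.integral_comp_comm _ (hT v₀).1, ← integral_smul_const]
      congr 1
      ext x
      rw [map_smul]
      by_cases hx : x ∈ DoubleCoset.quotToDoubleCoset C C D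
      · have hx' := (DoubleCoset.mem_quotToDoubleCoset_iff D x).1 hx
        obtain ⟨a, ha, b, hb, rfl⟩ := (DoubleCoset.eq C C g x).1 (hD.symm.trans hx'.symm)
        rw [map_mul, map_mul, mul_apply_eq_comp, mul_apply_eq_comp,
          hPC a ha, hv₀ b hb]
      · simp [hf, hx]
    have h3 : ∫ x, f x ∂μ ≠ 0 := by
      rw [hf, integral_indicator_const _ hDo.measurableSet, Complex.real_smul, mul_one]
      exact_mod_cast (ENNReal.toReal_pos (hDo.measure_pos μ ⟨g, hgD⟩).ne'
        hDc.measure_lt_top.ne).ne'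
    rw [Submodule.mem_span_singleton]
    refine ⟨(∫ x, f x ∂μ)⁻¹ * l, ?_⟩
    rw [mul_smul, ← h1, h2, inv_smul_smul₀ h3]
  -- `W` consists of the vectors whose whole orbit is sent by `P` into the line of `v₀`. It is
  -- closed, invariant and contains `v₀`, so irreducibility makes it all of `V`.
  let W : Submodule ℂ V :=
    ⨅ g, (Submodule.span ℂ {v₀}).comap (P ∘L π g : V →L[ℂ] V).toLinearMap
  have hW : ∀ w, w ∈ W ↔ ∀ g, P (π g w) ∈ Submodule.span ℂ {v₀} := fun w => by
    simp [W, Submodule.mem_iInf]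
  have hWc : IsClosed (W : Set V) := by
    have : (W : Set V) = ⋂ g, (P ∘L π g) ⁻¹' (Submodule.span ℂ {v₀} : Set V) := by
      ext w
      rw [SetLike.mem_coe, hW]
      simp
    rw [this]
    exact isClosed_iInter fun g =>
      (Submodule.closed_of_finiteDimensional _).preimage (P ∘L π g).continuous
  rcases hπ.irreducible W hWc fun g w hw => (hW _).2 fun h => by
    simpa using (hW w).1 hw (h * g) with h | h
  · have : v₀ ∈ W := (hW v₀).2 hbase
    rw [h, Submodule.mem_bot] at this
    exact absurd this hv₀'
  · have : v ∈ W := h ▸ Submodule.mem_top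
    simpa using (hW v).1 this 1

end Projection

/-! ### Rank one operators: absolute value and trace -/

section RankOne

variable {V : Type*} [NormedAddCommGroup V] [InnerProductSpace ℂ V]

open InnerProductSpace

lemma hasTrace_rankOne (v u : V) : HasTrace (rankOne ℂ v u) (inner ℂ u v) := by
  intro w b
  simpa only [rankOne_apply, inner_smul_right] using b.hasSum_inner_mul_inner u v

variable [CompleteSpace V]

/-- With `R = rankOne ℂ v u`, one has `R* R = ‖v‖² • rankOne ℂ u u`, while `rankOne ℂ u u` squares
to `‖u‖²` times itself; conclude by uniqueness of the positive square root. For `u = 0` both sides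
vanish. -/
lemma abs_rankOne (v u : V) :
    CFC.abs (rankOne ℂ v u) = (‖v‖ / ‖u‖) • rankOne ℂ u u := by
  rcases eq_or_ne u 0 with rfl | hu
  · simp
  have hu' : (‖u‖ : ℂ) ≠ 0 := by simpa using hu
  refine CFC.sqrt_unique ?_ (smul_nonneg (by positivity)
    ((ContinuousLinearMap.nonneg_iff_isPositive _).2 (isPositive_rankOne_self u)))
  ext w
  simp only [ContinuousLinearMap.star_eq_adjoint, mul_apply_eq_comp, adjoint_rankOne,
    smul_apply, rankOne_apply, map_smul, inner_self_eq_norm_sq_to_K, ← Complex.coe_smul,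
    smul_smul, Complex.ofReal_div]
  congr 1
  simp only [Complex.coe_algebraMap]
  field_simp

lemma isTraceClass_rankOne (v u : V) : IsTraceClass (rankOne ℂ v u) := by
  intro w b
  have := ((b.hasSum_inner_mul_inner u u).mul_left ((‖v‖ / ‖u‖ : ℝ) : ℂ)).summable
  refine this.congr fun i => ?_
  rw [abs_rankOne, smul_apply, rankOne_apply, ← Complex.coe_smul,
    inner_smul_right, inner_smul_right]

/-- A projection whose range is a line is an operator of rank one and trace one. -/
lemma exists_eq_rankOne {P : V →L[ℂ] V} {v : V} (hv : v ≠ 0) (hPv : P v = v)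
    (hP : ∀ w, P w ∈ Submodule.span ℂ {v}) : ∃ u, P = rankOne ℂ v u ∧ inner ℂ u v = (1 : ℂ) := by
  have hv' : inner ℂ v v ≠ 0 := inner_self_ne_zero.2 hv
  have key : ∀ w, inner ℂ ((inner ℂ v v)⁻¹ • P.adjoint v) w = (inner ℂ v v)⁻¹ * inner ℂ v (P w) := by
    intro w
    rw [inner_smul_left, ContinuousLinearMap.adjoint_inner_left, map_inv₀, inner_conj_symm]
  -- If `P w = c v`, then `c = ⟨v, P w⟩ / ⟨v, v⟩`; the representing vector of this functional of `w`
  -- is the witness.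
  refine ⟨(inner ℂ v v)⁻¹ • P.adjoint v, ?_, ?_⟩
  · ext w
    obtain ⟨c, hc⟩ := Submodule.mem_span_singleton.1 (hP w)
    rw [rankOne_apply, key, ← hc, inner_smul_right, mul_left_comm, inv_mul_cancel₀ hv', mul_one]
  · rw [key, hPv, inv_mul_cancel₀ hv']

end RankOne

/-! ### Volumes of boxes in the unipotent group -/

section Unipotent

variable {n : ℕ} {K : Type*} [Field K]

/-- The elementary matrix `1 + x E_{kj}`, for `k < j`. -/
def elementaryUnipotent {k j : Fin n} (h : k < j) (x : K) : unipotent n K :=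
  ⟨⟨Matrix.transvection k j x, Matrix.transvection k j (-x),
      by rw [Matrix.transvection_mul_transvection_same _ _ h.ne, add_neg_cancel,
        Matrix.transvection_zero],
      by rw [Matrix.transvection_mul_transvection_same _ _ h.ne, neg_add_cancel,
        Matrix.transvection_zero]⟩, by
    refine ⟨fun a b hab => ?_, fun a => ?_⟩
    · simp only [Matrix.transvection, Matrix.add_apply, Matrix.one_apply_ne hab.ne', zero_add]
      rw [Matrix.single_apply_of_ne]
      rintro ⟨rfl, rfl⟩
      exact lt_asymm h hab
    · simp only [Matrix.transvection, Matrix.add_apply, Matrix.one_apply_eq]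
      rw [Matrix.single_apply_of_ne, add_zero]
      rintro ⟨rfl, h'⟩
      exact h.ne' h'⟩

lemma elementaryUnipotent_inv_mul_apply {k j : Fin n} (h : k < j) (x : K) (u : unipotent n K)
    (i l : Fin n) :
    ((elementaryUnipotent h x)⁻¹ * u).1.1 i l =
      if i = k then u.1.1 k l - x * u.1.1 j l
      else u.1.1 i l := by
  change (Matrix.transvection k j (-x) * u.1.1) i l = _
  split_ifs with hi
  · subst hi
    rw [Matrix.transvection_mul_apply_same, neg_mul, ← sub_eq_add_neg]
  · rw [Matrix.transvection_mul_apply_of_ne _ _ _ _ hi]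

lemma continuous_unipotent_apply [TopologicalSpace K] (i j : Fin n) :
    Continuous fun u : unipotent n K => u.1.1 i j :=
  by
  have h : Continuous fun u : unipotent n K => u.1.1 :=
    Units.continuous_val.comp continuous_subtype_val
  exact h.matrix_elem i j

variable [ValuativeRel K]

/-- The upper triangular unipotent matrices whose `(i, j)` entry lies in `b_{ij}⁻¹ 𝒪`. -/
def unipotentBox (b : Fin n → Fin n → K) : Set (unipotent n K) :=
  {u | ∀ i j, i < j → b i j * u.1.1 i j ∈ (valuation K).integer}

lemma unipotentBox_congr {b b' : Fin n → Fin n → K} (h : ∀ i j, i < j → b i j = b' i j) :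
    unipotentBox b = unipotentBox b' :=
  Set.ext fun _ => forall₃_congr fun i j hij => by rw [h i j hij]

/-- If the `(k, j)` entry of the box `b` is enlarged from `𝒪` to `c⁻¹ 𝒪`, the new box is a disjoint
union of left translates of the old one, indexed by `𝒪 / c 𝒪`. -/
lemma elementaryUnipotent_inv_mul_mem_unipotentBox {b b' : Fin n → Fin n → K} {k j : Fin n}
    (hkj : k < j) {c : (valuation K).integer} (hc : c ≠ 0) (hb : b k j = 1) (hb' : b' k j = c)
    (hne : ∀ i l, i < l → (i, l) ≠ (k, j) → b' i l = b i l)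
    (hrow : ∀ l, j < l → b j l = 1 ∧ b k l = c) (r : (valuation K).integer) (u : unipotent n K) :
    (elementaryUnipotent hkj ((c : K)⁻¹ * r))⁻¹ * u ∈ unipotentBox b ↔
      u ∈ unipotentBox b' ∧ ∀ h : c * u.1.1 k j ∈ (valuation K).integer,
        Ideal.Quotient.mk (Ideal.span {c}) ⟨_, h⟩ = Ideal.Quotient.mk (Ideal.span {c}) r := by
  have hc' : (c : K) ≠ 0 := by simpa using hc
  have hlow : ∀ l, l < j → u.1.1 j l = 0 := fun l hl => u.2.1 j l hl
  have hdiag : u.1.1 j j = 1 := u.2.2 j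
  set x : K := (c : K)⁻¹ * r with hx
  have hcx : (c : K) * x = r := by rw [hx, mul_inv_cancel_left₀ hc']
  -- Dividing by `c` turns the congruence `c u_{kj} ≡ r` modulo `c` into integrality of `u_{kj} -
  -- x`.
  have hmk : ∀ h : c * u.1.1 k j ∈ (valuation K).integer,
      Ideal.Quotient.mk (Ideal.span {c}) ⟨_, h⟩ = Ideal.Quotient.mk (Ideal.span {c}) r ↔
        u.1.1 k j - x ∈ (valuation K).integer := by
    intro h
    rw [Ideal.Quotient.eq, Ideal.mem_span_singleton]
    constructor
    · rintro ⟨d, hd⟩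
      have hd' := congrArg Subtype.val hd
      push_cast at hd'
      rw [← hcx, ← mul_sub] at hd'
      rw [mul_left_cancel₀ hc' hd']
      exact d.2
    · intro hd
      refine ⟨⟨_, hd⟩, Subtype.ext ?_⟩
      push_cast
      rw [mul_sub, hcx]
  constructor
  · intro h
    have hkj' := h k j hkj
    rw [elementaryUnipotent_inv_mul_apply, if_pos rfl, hdiag, mul_one, hb, one_mul] at hkj'
    refine ⟨fun i l hil => ?_, fun h' => (hmk h').2 hkj'⟩
    have hil' := h i l hil
    rw [elementaryUnipotent_inv_mul_apply] at hil'
    split_ifs at hil' with hi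
    · subst hi
      -- Row `k` changes by `x` times row `j`: nothing left of column `j`, exactly `x` in column
      -- `j`, and to its right an element of `c⁻¹𝒪`, which `hrow` allows the box to absorb.
      rcases lt_trichotomy l j with hl | rfl | hl
      · rwa [hlow l hl, mul_zero, sub_zero, ← hne i l hil (by simp [hl.ne])] at hil'
      · rw [hb', show u.1.1 i l =
          (u.1.1 i l - x) + x by ring, mul_add, hcx]
        exact add_mem (mul_mem c.2 hkj') r.2
      · have hjl := h j l hl
        rw [elementaryUnipotent_inv_mul_apply, if_neg hkj.ne', (hrow l hl).1, one_mul] at hjl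
        rw [hne i l hil (by simp [hl.ne'])]
        rw [(hrow l hl).2, mul_sub, ← mul_assoc, hcx] at hil'
        rw [(hrow l hl).2]
        simpa using add_mem hil' (mul_mem r.2 hjl)
    · rwa [hne i l hil (by simp [hi])]
  · rintro ⟨h, h'⟩ i l hil
    have hkj' : u.1.1 k j - x ∈ (valuation K).integer := by
      have := h k j hkj
      rw [hb'] at this
      exact (hmk this).1 (h' this)
    have hil' := h i l hil
    rw [elementaryUnipotent_inv_mul_apply]
    split_ifs with hi
    · subst hi
      rcases lt_trichotomy l j with hl | rfl | hl
      · rwa [hlow l hl, mul_zero, sub_zero, ← hne i l hil (by simp [hl.ne])]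
      · rwa [hb, one_mul, hdiag, mul_one]
      · have hjl := h j l hl
        rw [hne j l hl (by simp [hkj.ne']), (hrow l hl).1, one_mul] at hjl
        rw [hne i l hil (by simp [hl.ne']), (hrow l hl).2] at hil'
        rw [(hrow l hl).2, mul_sub, ← mul_assoc, hcx]
        exact sub_mem hil' (mul_mem r.2 hjl)
    · rwa [← hne i l hil (by simp [hi])]

/-- An integral unipotent matrix has determinant 1, so its inverse is automatically integral. -/
lemma mem_maxCompact_iff_of_mem_unipotent (u : unipotent n K) :
    (u : GL (Fin n) K) ∈ maxCompact n K ↔ u ∈ unipotentBox fun _ _ => 1 := by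
  constructor
  · intro h i j _
    rw [one_mul]
    exact (mem_maxCompact_iff.1 h).1 i j
  · intro h
    have hint : ∀ i j, u.1.1 i j ∈ (valuation K).integer := by
      intro i j
      rcases lt_trichotomy i j with hij | rfl | hij
      · simpa using h i j hij
      · have : u.1.1 i i = 1 := u.2.2 i
        rw [this]; exact one_mem _
      · have : u.1.1 i j = 0 := u.2.1 i j hij
        rw [this]; exact zero_mem _
    let A : Matrix (Fin n) (Fin n) (valuation K).integer := Matrix.of fun i j => ⟨_, hint i j⟩
    have hA : A.det = 1 := by
      rw [Matrix.det_of_isUpperTriangular]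
      · exact Finset.prod_eq_one fun i _ => Subtype.ext (u.2.2 i)
      · intro i j hij
        exact Subtype.ext (u.2.1 i j hij)
    exact ⟨Matrix.GeneralLinearGroup.mk'' A (by rw [hA]; exact isUnit_one), by ext i j; rfl⟩

variable [TopologicalSpace K] [IsNonarchimedeanLocalField K]

variable (n K) in
lemma isClosed_unipotent : IsClosed (unipotent n K : Set (GL (Fin n) K)) := by
  have := t2Space_of_localField K
  have hc : ∀ i j, Continuous fun u : GL (Fin n) K => (u : Matrix (Fin n) (Fin n) K) i j :=
    fun i j => Units.continuous_val.matrix_elem i j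
  have : (unipotent n K : Set (GL (Fin n) K)) =
      (⋂ i, ⋂ j, ⋂ _ : j < i, {u : GL (Fin n) K | (u : Matrix (Fin n) (Fin n) K) i j = 0}) ∩
        ⋂ i, {u : GL (Fin n) K | (u : Matrix (Fin n) (Fin n) K) i i = 1} := by
    ext u
    simp [unipotent]
  rw [this]
  refine IsClosed.inter ?_ ?_
  · exact isClosed_iInter fun i => isClosed_iInter fun j => isClosed_iInter fun _ =>
      isClosed_eq (hc i j) continuous_const
  · exact isClosed_iInter fun i => isClosed_eq (hc i i) continuous_const

lemma isOpen_unipotentBox (b : Fin n → Fin n → K) : IsOpen (unipotentBox b) := by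
  simp only [unipotentBox, Set.ofPred_forall]
  refine isOpen_iInter_of_finite fun i => isOpen_iInter_of_finite fun j =>
    isOpen_iInter_of_finite fun _ => ?_
  exact (isOpen_integer K).preimage (continuous_const.mul (continuous_unipotent_apply i j))

variable (n K) in
lemma isCompact_unipotentBox_one :
    IsCompact (unipotentBox fun _ _ => (1 : K) : Set (unipotent n K)) := by
  have h : (unipotentBox fun _ _ => (1 : K) : Set (unipotent n K)) =
      Subtype.val ⁻¹' (maxCompact n K : Set (GL (Fin n) K)) :=
    Set.ext fun u => (mem_maxCompact_iff_of_mem_unipotent u).symm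
  rw [h]
  exact (isClosed_unipotent n K).isClosedEmbedding_subtypeVal.isCompact_preimage
    (isCompact_maxCompact n K)

variable [MeasurableSpace (GL (Fin n) K)] [BorelSpace (GL (Fin n) K)]
  {ν : Measure (unipotent n K)} [ν.IsMulLeftInvariant]

/-- The residue class of `c u_{kj}` modulo `c` determines which translate of the old box contains
`u`; the translates are finitely many and have equal measure. -/
lemma unipotentBox_enlarge {ϖ : K} (hϖ : absK ϖ = (residueCard K : ℝ)⁻¹)
    {b b' : Fin n → Fin n → K} {k j : Fin n}
    (hkj : k < j) {c : (valuation K).integer} (hc : c ≠ 0) (hb : b k j = 1) (hb' : b' k j = c)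
    (hne : ∀ i l, i < l → (i, l) ≠ (k, j) → b' i l = b i l)
    (hrow : ∀ l, j < l → b j l = 1 ∧ b k l = c) (hcpt : IsCompact (unipotentBox b)) :
    IsCompact (unipotentBox b') ∧ ν (unipotentBox b') =
      Nat.card ((valuation K).integer ⧸ Ideal.span {c}) * ν (unipotentBox b) := by
  have := finite_quotient_span hϖ hc
  let T : (valuation K).integer ⧸ Ideal.span {c} → unipotent n K :=
    fun q => elementaryUnipotent hkj ((c : K)⁻¹ * q.out)
  have hT : ∀ q u, (T q)⁻¹ * u ∈ unipotentBox b ↔ u ∈ unipotentBox b' ∧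
      ∀ h : c * u.1.1 k j ∈ (valuation K).integer,
        Ideal.Quotient.mk (Ideal.span {c}) ⟨_, h⟩ = q := fun q u => by
    rw [elementaryUnipotent_inv_mul_mem_unipotentBox hkj hc hb hb' hne hrow,
      Ideal.Quotient.mk_out]
  have hmem : ∀ u ∈ unipotentBox b',
      c * u.1.1 k j ∈ (valuation K).integer := fun u hu =>
    hb' ▸ hu k j hkj
  have hU : unipotentBox b' = ⋃ q, ((T q)⁻¹ * ·) ⁻¹' unipotentBox b := by
    ext u
    simp only [Set.mem_iUnion, Set.mem_preimage, hT]
    exact ⟨fun hu => ⟨Ideal.Quotient.mk _ ⟨_, hmem u hu⟩, hu, fun _ => rfl⟩, fun ⟨_, hu, _⟩ => hu⟩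
  have hdisj : Pairwise (Function.onFun Disjoint fun q => ((T q)⁻¹ * ·) ⁻¹' unipotentBox b) := by
    intro q q' hq
    refine Set.disjoint_left.2 fun u hu hu' => hq ?_
    obtain ⟨h1, h2⟩ := (hT q u).1 hu
    rw [← h2 (hmem u h1), ((hT q' u).1 hu').2 (hmem u h1)]
  constructor
  · rw [hU]
    exact isCompact_iUnion fun q => (Homeomorph.mulLeft (T q)⁻¹).isCompact_preimage.2 hcpt
  · rw [hU, measure_iUnion hdisj fun q =>
      ((isOpen_unipotentBox b).preimage (continuous_const_mul _)).measurableSet]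
    simp only [measure_preimage_mul]
    have := Fintype.ofFinite ((valuation K).integer ⧸ Ideal.span {c})
    rw [tsum_fintype, Finset.sum_const, Finset.card_univ, Nat.card_eq_fintype_card, nsmul_eq_mul]

/-- Row `k` is relaxed from the last column leftwards, `m` counting the columns done. This order is
forced by `hrow` in `unipotentBox_enlarge`: entries of row `k` to the right must be relaxed already,
and lower rows must still be integral. -/
lemma unipotentBox_row {ϖ : K} (hϖ : absK ϖ = (residueCard K : ℝ)⁻¹)
    {a : Fin n → (valuation K).integer} (ha : ∀ i, a i ≠ 0) (k : Fin n)
    (hcpt : IsCompact (unipotentBox fun i _ => if i < k then (a i : K) else 1)) (m : ℕ)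
    (hm : m + k + 1 ≤ n) :
    IsCompact (unipotentBox fun i l =>
        if i < k ∨ i = k ∧ n ≤ (l : ℕ) + m then (a i : K) else 1) ∧
      ν (unipotentBox fun i l => if i < k ∨ i = k ∧ n ≤ (l : ℕ) + m then (a i : K) else 1) =
        Nat.card ((valuation K).integer ⧸ Ideal.span {a k}) ^ m *
          ν (unipotentBox fun i _ => if i < k then (a i : K) else 1) := by
  induction m with
  | zero =>
    have : (unipotentBox fun i l => if i < k ∨ i = k ∧ n ≤ (l : ℕ) + 0 then (a i : K) else 1) =
        unipotentBox fun i _ => if i < k then (a i : K) else 1 := by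
      congr! 6 with i l
      have := l.2
      simp only [or_iff_left_iff_imp]
      omega
    rw [this]
    exact ⟨hcpt, by simp⟩
  | succ m ih =>
    obtain ⟨h1, h2⟩ := ih (by omega)
    -- Columns `l ≥ n - m` are done, so the next one is `n - 1 - m`; the bound on `m` keeps it right
    -- of the diagonal.
    have hkj : k < (⟨n - 1 - m, by omega⟩ : Fin n) := by
      rw [Fin.lt_def]; simp only; omega
    have := unipotentBox_enlarge (ν := ν) hϖ (k := k) (j := ⟨n - 1 - m, by omega⟩)
      (b' := fun i l => if i < k ∨ i = k ∧ n ≤ (l : ℕ) + (m + 1) then (a i : K) else 1)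
      hkj (ha k) ?_ ?_ ?_ ?_ h1
    · rw [h2, ← mul_assoc, ← pow_succ'] at this
      exact this
    · rw [if_neg]
      simp only [lt_self_iff_false, true_and, false_or, not_le]
      omega
    · rw [if_pos]
      refine Or.inr ⟨rfl, ?_⟩
      simp only
      omega
    · intro i l _ hil
      congr 1
      have : i = k → (l : ℕ) ≠ n - 1 - m := fun hi hl => hil (Prod.ext hi (Fin.ext hl))
      simp only [Fin.lt_def, Fin.ext_iff, eq_iff_iff] at this ⊢
      omega
    · intro l hl
      rw [Fin.lt_def] at hl hkj
      simp only at hl hkj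
      refine ⟨if_neg ?_, if_pos ?_⟩
      · simp only [Fin.lt_def, Fin.ext_iff]
        omega
      · exact Or.inr ⟨rfl, by omega⟩

/-- Rows are relaxed from the top down; row `i` has `n - 1 - i` entries above the diagonal, each
contributing one index. -/
lemma unipotentBox_measure {ϖ : K} (hϖ : absK ϖ = (residueCard K : ℝ)⁻¹)
    (hν : ν (unipotentBox fun _ _ => 1) = 1)
    {a : Fin n → (valuation K).integer} (ha : ∀ i, a i ≠ 0) :
    IsCompact (unipotentBox fun i _ => (a i : K)) ∧ ν (unipotentBox fun i _ => (a i : K)) =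
      ∏ i, (Nat.card ((valuation K).integer ⧸ Ideal.span {a i}) : ENNReal) ^ (n - 1 - (i : ℕ)) := by
  suffices h : ∀ k ≤ n,
      IsCompact (unipotentBox fun i _ => if (i : ℕ) < k then (a i : K) else 1) ∧
      ν (unipotentBox fun i _ => if (i : ℕ) < k then (a i : K) else 1) =
        ∏ i : Fin n, if (i : ℕ) < k then
          (Nat.card ((valuation K).integer ⧸ Ideal.span {a i}) : ENNReal) ^ (n - 1 - (i : ℕ))
          else 1 by
    simpa using h n le_rfl
  intro k hk
  induction k with
  | zero => simpa using ⟨isCompact_unipotentBox_one n K, hν⟩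
  | succ k ih =>
    obtain ⟨h1, h2⟩ := ih (by omega)
    have := unipotentBox_row (ν := ν) hϖ ha ⟨k, hk⟩ h1 (n - 1 - k) (by simp only; omega)
    -- After `n - 1 - k` steps exactly the columns `l > k` of row `k` are relaxed; the remaining
    -- ones are not constrained by the box.
    have hbox : (unipotentBox fun i l => if i < (⟨k, hk⟩ : Fin n) ∨
        i = ⟨k, hk⟩ ∧ n ≤ (l : ℕ) + (n - 1 - k) then (a i : K) else 1) =
        unipotentBox fun i _ => if (i : ℕ) < k + 1 then (a i : K) else 1 := by
      refine unipotentBox_congr fun i l hil => ?_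
      congr 1
      simp only [Fin.lt_def, Fin.ext_iff, eq_iff_iff] at hil ⊢
      have := l.2
      omega
    rw [hbox] at this
    refine ⟨this.1, this.2.trans ?_⟩
    have hlt : ∀ i : Fin n, i < (⟨k, hk⟩ : Fin n) ↔ (i : ℕ) < k := fun i => Fin.lt_def
    simp only [hlt]
    rw [h2]
    have hsplit : ∀ i : Fin n, (if (i : ℕ) < k + 1 then
        (Nat.card ((valuation K).integer ⧸ Ideal.span {a i}) : ENNReal) ^ (n - 1 - (i : ℕ)) else 1) =
        (if i = ⟨k, hk⟩ then
          (Nat.card ((valuation K).integer ⧸ Ideal.span {a i}) : ENNReal) ^ (n - 1 - (i : ℕ))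
          else 1) *
        (if (i : ℕ) < k then
          (Nat.card ((valuation K).integer ⧸ Ideal.span {a i}) : ENNReal) ^ (n - 1 - (i : ℕ))
          else 1) := by
      intro i
      rcases lt_trichotomy (i : ℕ) k with h | h | h
      · rw [if_pos (by omega), if_neg (by simp [Fin.ext_iff, h.ne]), if_pos h, one_mul]
      · rw [if_pos (by omega), if_pos (Fin.ext h), if_neg (by omega), mul_one]
      · rw [if_neg (by omega), if_neg (by simp [Fin.ext_iff, h.ne']), if_neg (by omega), mul_one]
    simp only [hsplit, Finset.prod_mul_distrib, Finset.prod_ite_eq', Finset.mem_univ, if_true]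

end Unipotent

/-! ### Multiple geometric series -/

section PiSums

/-- Absolute summability is carried through the induction because multiplying two series requires
it. -/
lemma hasSum_prod_pi {ι : Type*} {n : ℕ} {f : Fin n → ι → ℂ} {s : Fin n → ℂ}
    (hf : ∀ j, HasSum (f j) (s j)) (hf' : ∀ j, Summable fun i => ‖f j i‖) :
    HasSum (fun m : Fin n → ι => ∏ j, f j (m j)) (∏ j, s j) ∧
      Summable fun m : Fin n → ι => ‖∏ j, f j (m j)‖ := by
  induction n with
  | zero =>
    simp only [Finset.univ_eq_empty, Finset.prod_empty]
    exact ⟨by simp, Summable.of_finite⟩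
  | succ n ih =>
    obtain ⟨h1, h2⟩ := ih (fun j => hf j.succ) (fun j => hf' j.succ)
    rw [← (Fin.consEquiv fun _ : Fin (n + 1) => ι).hasSum_iff,
      ← (Fin.consEquiv fun _ : Fin (n + 1) => ι).summable_iff]
    have hcomp : ∀ p : ι × (Fin n → ι),
        ∏ j, f j (Fin.consEquiv (fun _ : Fin (n + 1) => ι) p j) =
          f 0 p.1 * ∏ j, f (Fin.succ j) (p.2 j) := fun p => by
      rw [Fin.prod_univ_succ]
      simp [Fin.consEquiv]
    simp only [Function.comp_def, hcomp, Fin.prod_univ_succ (n := n) (f := s)]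
    have hm := summable_mul_of_summable_norm (f := f 0)
      (g := fun m : Fin n → ι => ∏ j, f (Fin.succ j) (m j)) (hf' 0) h2
    have hm' := Summable.mul_norm (f := f 0)
      (g := fun m : Fin n → ι => ∏ j, f (Fin.succ j) (m j)) (hf' 0) h2
    have hs := HasSum.mul (f := f 0)
      (g := fun m : Fin n → ι => ∏ j, f (Fin.succ j) (m j)) (hf 0) h1 hm
    exact ⟨hs, hm'⟩

lemma hasSum_geometric_int {z : ℂ} (hz : ‖z‖ < 1) :
    HasSum (fun m : ℤ => if 0 ≤ m then z ^ m else 0) (1 - z)⁻¹ ∧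
      Summable fun m : ℤ => ‖if 0 ≤ m then z ^ m else 0‖ := by
  have hinj : Function.Injective ((↑) : ℕ → ℤ) := Nat.cast_injective
  have hout : ∀ m : ℤ, m ∉ Set.range ((↑) : ℕ → ℤ) → (if 0 ≤ m then z ^ m else 0) = 0 := by
    intro m hm
    rw [if_neg]
    exact fun h => hm ⟨m.toNat, Int.toNat_of_nonneg h⟩
  constructor
  · rw [← hinj.hasSum_iff hout]
    simpa [Function.comp_def] using hasSum_geometric_of_norm_lt_one hz
  · rw [← hinj.summable_iff fun m hm => by rw [hout m hm, norm_zero]]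
    simpa [Function.comp_def] using summable_geometric_of_lt_one (norm_nonneg z) hz

/-- The generating series of the cone of nonnegative exponents. -/
lemma hasSum_cone {n : ℕ} {z : Fin n → ℂ} (hz : ∀ j, ‖z j‖ < 1) :
    HasSum (fun m : Fin n → ℤ => if ∀ j, 0 ≤ m j then ∏ j, z j ^ m j else 0)
        (∏ j, (1 - z j)⁻¹) ∧
      Summable fun m : Fin n → ℤ => ‖if ∀ j, 0 ≤ m j then ∏ j, z j ^ m j else 0‖ := by
  have h := hasSum_prod_pi (fun j => (hasSum_geometric_int (hz j)).1)
    (fun j => (hasSum_geometric_int (hz j)).2)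
  simpa only [Finset.prod_ite_zero, Finset.mem_univ, true_imp_iff] using h

end PiSums

/-! ### The Satake transform of the test function and of its pieces -/

section Satake

variable {n : ℕ} {K : Type*} [Field K]

lemma torus_mul_apply (a : Fin n → Kˣ) (g : GL (Fin n) K) (i j : Fin n) :
    (torus a * g : GL (Fin n) K).1 i j = a i * g.1 i j := by
  change (Matrix.diagonal (fun i => (a i : K)) * g.1) i j = _
  rw [Matrix.diagonal_mul]

lemma torus_apply (a : Fin n → Kˣ) : (torus a).1 = Matrix.diagonal fun i => (a i : K) := rfl

lemma det_torus_mul (a : Fin n → Kˣ) (u : unipotent n K) :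
    (torus a * (u : GL (Fin n) K)).1.det = ∏ i, (a i : K) := by
  have : u.1.1.det = 1 := by
    rw [Matrix.det_of_isUpperTriangular]
    · exact Finset.prod_eq_one fun i _ => u.2.2 i
    · intro i j hij
      exact u.2.1 i j hij
  rw [Units.val_mul, Matrix.det_mul, this, mul_one, torus_apply, Matrix.det_diagonal]

variable [ValuativeRel K]

lemma torus_mem_integralMatrices_iff (a : Fin n → Kˣ) :
    (torus a).1 ∈ integralMatrices n K ↔ ∀ i, (a i : K) ∈ (valuation K).integer := by
  rw [torus_apply]
  refine ⟨fun h i => by simpa using h i i, fun h i j => ?_⟩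
  rw [Matrix.diagonal_apply]
  split_ifs
  exacts [h i, zero_mem _]

lemma torus_mul_mem_integralMatrices_iff (a : Fin n → Kˣ) (u : unipotent n K) :
    (torus a * (u : GL (Fin n) K)).1 ∈ integralMatrices n K ↔
      (∀ i, (a i : K) ∈ (valuation K).integer) ∧ u ∈ unipotentBox fun i _ => (a i : K) := by
  constructor
  · refine fun h => ⟨fun i => ?_, fun i j _ => ?_⟩
    · have := h i i
      rwa [torus_mul_apply, u.2.2 i, mul_one] at this
    · have := h i j
      rwa [torus_mul_apply] at this
  · rintro ⟨h1, h2⟩ i j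
    rw [torus_mul_apply]
    rcases lt_trichotomy i j with hij | rfl | hij
    · exact h2 i j hij
    · rw [u.2.2 i, mul_one]; exact h1 i
    · rw [u.2.1 i j hij, mul_zero]; exact zero_mem _

variable [TopologicalSpace K] [IsNonarchimedeanLocalField K]

lemma testFunction_torus_mul {a : Fin n → Kˣ} (ha : ∀ i, (a i : K) ∈ (valuation K).integer)
    (u : unipotent n K) : testFunction n K (torus a * (u : GL (Fin n) K)) =
      (unipotentBox fun i _ => (a i : K)).indicator
        (fun _ => (((∏ i, absK (a i : K)) ^ (((n : ℝ) - 1) / 2) : ℝ) : ℂ)) u := by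
  by_cases hu : u ∈ unipotentBox fun i _ => (a i : K)
  · rw [Set.indicator_of_mem hu, testFunction_of_mem
      ((torus_mul_mem_integralMatrices_iff a u).2 ⟨ha, hu⟩), det_torus_mul, absK_prod]
  · rw [Set.indicator_of_notMem hu, testFunction_of_notMem]
    exact fun h => hu ((torus_mul_mem_integralMatrices_iff a u).1 h).2

lemma testFunction_torus_mul_eq_zero {a : Fin n → Kˣ}
    (ha : ¬ ∀ i, (a i : K) ∈ (valuation K).integer) (u : unipotent n K) :
    testFunction n K (torus a * (u : GL (Fin n) K)) = 0 :=
  testFunction_of_notMem fun h => ha ((torus_mul_mem_integralMatrices_iff a u).1 h).1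

/-- The exponent of `x i` is `(n-1-2i)/2 - (n-1-i) + (n-1)/2 = 0`. This cancellation dictates the
power of `|det|` in the test function. -/
lemma sqrt_modulus_mul (x : Fin n → ℝ) (hx : ∀ i, 0 < x i) :
    Real.sqrt (∏ j, x j ^ ((n : ℤ) - 1 - 2 * (j : ℤ))) * ((∏ i, (x i)⁻¹ ^ (n - 1 - (i : ℕ))) *
      (∏ i, x i) ^ (((n : ℝ) - 1) / 2)) = 1 := by
  rw [Real.sqrt_eq_rpow, ← Real.finsetProd_rpow _ _ fun i _ => (zpow_pos (hx i) _).le,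
    ← Real.finsetProd_rpow _ _ fun i _ => (hx i).le, ← Finset.prod_mul_distrib,
    ← Finset.prod_mul_distrib]
  refine Finset.prod_eq_one fun i _ => ?_
  have hi : ((n - 1 - (i : ℕ) : ℕ) : ℝ) = (n : ℝ) - 1 - (i : ℕ) := by
    have := i.2
    rw [Nat.cast_sub (by omega), Nat.cast_sub (by omega), Nat.cast_one]
  rw [← Real.rpow_intCast, ← Real.rpow_mul (hx i).le, ← Real.rpow_neg_one, ← Real.rpow_natCast,
    ← Real.rpow_mul (hx i).le, ← Real.rpow_add (hx i), ← Real.rpow_add (hx i), hi]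
  push_cast
  rw [show ((n : ℝ) - 1 - 2 * (i : ℕ)) * (1 / 2) + (-1 * ((n : ℝ) - 1 - (i : ℕ)) +
    ((n : ℝ) - 1) / 2) = 0 by ring, Real.rpow_zero]

/-- Positivity excludes cancellation between double cosets, which justifies the interchange of sums
in `hasSum_scalars`. -/
lemma exists_satake_eq_ofReal [MeasurableSpace (GL (Fin n) K)]
    {ν : Measure (unipotent n K)} {f : GL (Fin n) K → ℂ} (hf : ∀ x, ∃ r : ℝ, 0 ≤ r ∧ f x = r)
    (a : Fin n → Kˣ) : ∃ r : ℝ, 0 ≤ r ∧ satake ν f a = r := by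
  choose g hg0 hg using hf
  refine ⟨Real.sqrt (modulus a) * ∫ u : unipotent n K, g (torus a * (u : GL (Fin n) K)) ∂ν,
    mul_nonneg (Real.sqrt_nonneg _) (integral_nonneg fun u => hg0 _), ?_⟩
  rw [satake, Complex.ofReal_mul, ← integral_complex_ofReal]
  simp only [hg]

variable [MeasurableSpace (GL (Fin n) K)] [BorelSpace (GL (Fin n) K)]
  {ν : Measure (unipotent n K)} [ν.IsMulLeftInvariant]

lemma isCompact_unipotentBox {ϖ : K} (hϖ : absK ϖ = (residueCard K : ℝ)⁻¹)
    (hν : ν (unipotentBox fun _ _ => 1) = 1)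
    {a : Fin n → Kˣ} (ha : ∀ i, (a i : K) ∈ (valuation K).integer) :
    IsCompact (unipotentBox fun i _ => (a i : K)) ∧
      ν.real (unipotentBox fun i _ => (a i : K)) =
        ∏ i, (absK (a i : K))⁻¹ ^ (n - 1 - (i : ℕ)) := by
  have h0 : ∀ i, (⟨a i, ha i⟩ : (valuation K).integer) ≠ 0 := fun i h =>
    (a i).ne_zero (congrArg Subtype.val h)
  obtain ⟨h1, h2⟩ := unipotentBox_measure hϖ hν h0
  refine ⟨h1, ?_⟩
  rw [Measure.real, h2, ENNReal.toReal_prod]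
  refine Finset.prod_congr rfl fun i _ => ?_
  rw [ENNReal.toReal_pow, ENNReal.toReal_natCast, eq_inv_of_mul_eq_one_left
    (card_quotient_span hϖ (h0 i))]

lemma integrable_testFunction {ϖ : K} (hϖ : absK ϖ = (residueCard K : ℝ)⁻¹)
    (hν : ν (unipotentBox fun _ _ => 1) = 1) [IsFiniteMeasureOnCompacts ν] (a : Fin n → Kˣ) :
    Integrable (fun u : unipotent n K => testFunction n K (torus a * (u : GL (Fin n) K))) ν := by
  by_cases ha : ∀ i, (a i : K) ∈ (valuation K).integer
  · simp only [testFunction_torus_mul ha]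
    refine (integrable_indicator_iff (isOpen_unipotentBox _).measurableSet).2 ?_
    exact integrableOn_const (isCompact_unipotentBox hϖ hν ha).1.measure_lt_top.ne
  · simp only [testFunction_torus_mul_eq_zero ha]
    exact integrable_zero _ _ _

lemma satake_testFunction {ϖ : K} (hϖ : absK ϖ = (residueCard K : ℝ)⁻¹)
    (hν : ν (unipotentBox fun _ _ => 1) = 1) (a : Fin n → Kˣ) :
    satake ν (testFunction n K) a =
      open Classical in if (torus a).1 ∈ integralMatrices n K then 1 else 0 := by
  rw [satake]
  by_cases ha : ∀ i, (a i : K) ∈ (valuation K).integer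
  · rw [if_pos ((torus_mem_integralMatrices_iff a).2 ha)]
    simp only [testFunction_torus_mul ha]
    rw [integral_indicator_const _ (isOpen_unipotentBox _).measurableSet,
      (isCompact_unipotentBox hϖ hν ha).2, Complex.real_smul]
    exact_mod_cast sqrt_modulus_mul (fun i => absK (a i : K)) fun i => absK_pos (a i).ne_zero
  · rw [if_neg (mt (torus_mem_integralMatrices_iff a).1 ha)]
    simp only [testFunction_torus_mul_eq_zero ha, integral_zero, mul_zero]

/-- The Satake transform of the test function is the sum of the Satake transforms of its
restrictions to the double cosets. -/
lemma hasSum_satake_indicator {ϖ : K} (hϖ : absK ϖ = (residueCard K : ℝ)⁻¹)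
    (hν : ν (unipotentBox fun _ _ => 1) = 1) [IsFiniteMeasureOnCompacts ν] (a : Fin n → Kˣ) :
    HasSum (fun D => satake ν ((DoubleCoset.quotToDoubleCoset (maxCompact n K) (maxCompact n K)
      D).indicator (testFunction n K)) a) (satake ν (testFunction n K) a) := by
  have hcont : Continuous fun u : unipotent n K => torus a * (u : GL (Fin n) K) :=
    continuous_const.mul continuous_subtype_val
  have hopen : ∀ D, IsOpen ((fun u : unipotent n K => torus a * (u : GL (Fin n) K)) ⁻¹'
      DoubleCoset.quotToDoubleCoset (maxCompact n K) (maxCompact n K) D) := fun D =>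
    (isOpen_quotToDoubleCoset (isOpen_maxCompact n K) D).preimage hcont
  -- For fixed `a` the integrand lives on a compact box, which is covered by finitely many of the
  -- open double cosets; the sum over `D` is thus finite.
  obtain ⟨t, ht⟩ : ∃ t : Finset (DoubleCoset.Quotient (maxCompact n K : Set (GL (Fin n) K))
      (maxCompact n K)), ∀ u : unipotent n K,
      DoubleCoset.mk (maxCompact n K) (maxCompact n K) (torus a * (u : GL (Fin n) K)) ∉ t →
        testFunction n K (torus a * (u : GL (Fin n) K)) = 0 := by
    by_cases ha : ∀ i, (a i : K) ∈ (valuation K).integer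
    · obtain ⟨t, ht⟩ := (isCompact_unipotentBox hϖ hν ha).1.elim_finite_subcover _ hopen
        fun u _ => Set.mem_iUnion.2 ⟨_, (DoubleCoset.mem_quotToDoubleCoset_iff _ _).2 rfl⟩
      refine ⟨t, fun u hu => ?_⟩
      rw [testFunction_torus_mul ha, Set.indicator_of_notMem]
      intro hu'
      obtain ⟨D, hD, hD'⟩ := Set.mem_iUnion₂.1 (ht hu')
      rw [Set.mem_preimage, DoubleCoset.mem_quotToDoubleCoset_iff] at hD'
      exact hu (hD' ▸ hD)
    · exact ⟨∅, fun u _ => testFunction_torus_mul_eq_zero ha u⟩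
  have hzero : ∀ D (u : unipotent n K), D ≠
      DoubleCoset.mk (maxCompact n K) (maxCompact n K) (torus a * (u : GL (Fin n) K)) →
      (DoubleCoset.quotToDoubleCoset (maxCompact n K) (maxCompact n K) D).indicator
        (testFunction n K) (torus a * (u : GL (Fin n) K)) = 0 := fun D u h =>
    Set.indicator_of_notMem (fun h' => h ((DoubleCoset.mem_quotToDoubleCoset_iff _ _).1 h').symm) _
  have hself : ∀ u : unipotent n K, (DoubleCoset.quotToDoubleCoset (maxCompact n K)
      (maxCompact n K) (DoubleCoset.mk (maxCompact n K) (maxCompact n K)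
        (torus a * (u : GL (Fin n) K)))).indicator (testFunction n K)
        (torus a * (u : GL (Fin n) K)) = testFunction n K (torus a * (u : GL (Fin n) K)) :=
    fun u => Set.indicator_of_mem ((DoubleCoset.mem_quotToDoubleCoset_iff _ _).2 rfl) _
  have hsum : satake ν (testFunction n K) a = ∑ D ∈ t, satake ν ((DoubleCoset.quotToDoubleCoset
      (maxCompact n K) (maxCompact n K) D).indicator (testFunction n K)) a := by
    simp only [satake]
    rw [← Finset.mul_sum, ← integral_finsetSum]
    · refine congrArg _ (integral_congr_ae (.of_forall fun u => ?_))
      simp only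
      by_cases hu : DoubleCoset.mk (maxCompact n K) (maxCompact n K)
          (torus a * (u : GL (Fin n) K)) ∈ t
      · rw [Finset.sum_eq_single_of_mem _ hu fun D _ h => hzero D u h, hself]
      · rw [ht u hu, Finset.sum_eq_zero fun D hD => hzero D u fun h => hu (h ▸ hD)]
    · intro D _
      exact (integrable_testFunction hϖ hν a).indicator (hopen D).measurableSet
  rw [hsum]
  refine hasSum_sum_of_ne_finset_zero fun D hD => ?_
  rw [satake, integral_eq_zero_of_ae, mul_zero]
  refine .of_forall fun u => ?_
  simp only [Pi.zero_apply]
  by_cases h : D = DoubleCoset.mk (maxCompact n K) (maxCompact n K) (torus a * (u : GL (Fin n) K))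
  · rw [h, hself, ht u (h ▸ hD)]
  · exact hzero D u h

/-- The scalars through which the restrictions of the test function to the double cosets act add up
to the local `L`-factor. -/
lemma hasSum_scalars {ϖ : Kˣ} (hϖ : absK (ϖ : K) = (residueCard K : ℝ)⁻¹)
    (hν : ν (unipotentBox fun _ _ => 1) = 1) [IsFiniteMeasureOnCompacts ν] {α : Fin n → ℂˣ}
    (hα : ∀ j, ‖(α j : ℂ)‖ < 1) :
    HasSum (fun D => ∑' m : Fin n → ℤ, satake ν ((DoubleCoset.quotToDoubleCoset (maxCompact n K)
      (maxCompact n K) D).indicator (testFunction n K)) (fun j => ϖ ^ m j) *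
        ∏ j, ((α j ^ m j : ℂˣ) : ℂ)) (∏ j, (1 - (α j : ℂ))⁻¹) := by
  have hq : (1 : ℝ) < residueCard K := by exact_mod_cast one_lt_residueCard K
  have hint : ∀ m : Fin n → ℤ, (torus fun j => ϖ ^ m j).1 ∈ integralMatrices n K ↔
      ∀ j, 0 ≤ m j := by
    intro m
    rw [torus_mem_integralMatrices_iff]
    refine forall_congr' fun j => ?_
    rw [← absK_le_one_iff, Units.val_zpow_eq_zpow_val, absK_zpow, hϖ, inv_zpow', ← zpow_zero
      (residueCard K : ℝ), zpow_le_zpow_iff_right₀ hq]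
    omega
  have hreal : ∀ D (x : GL (Fin n) K), ∃ r : ℝ, 0 ≤ r ∧ (DoubleCoset.quotToDoubleCoset
      (maxCompact n K) (maxCompact n K) D).indicator (testFunction n K) x = r := by
    intro D x
    by_cases hx : x ∈ DoubleCoset.quotToDoubleCoset (maxCompact n K) (maxCompact n K) D
    · rw [Set.indicator_of_mem hx]
      by_cases hx' : x.1 ∈ integralMatrices n K
      · exact ⟨_, Real.rpow_nonneg (absK_nonneg _) _, testFunction_of_mem hx'⟩
      · exact ⟨0, le_rfl, by rw [testFunction_of_notMem hx', Complex.ofReal_zero]⟩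
    · exact ⟨0, le_rfl, by rw [Set.indicator_of_notMem hx, Complex.ofReal_zero]⟩
  choose r hr0 hr using fun D (m : Fin n → ℤ) =>
    exists_satake_eq_ofReal (ν := ν) (hreal D) fun j => ϖ ^ m j
  have hrsum : ∀ m : Fin n → ℤ, HasSum (fun D => r D m) (if ∀ j, 0 ≤ m j then 1 else 0) := by
    intro m
    have h := hasSum_satake_indicator hϖ hν fun j => ϖ ^ m j
    rw [satake_testFunction hϖ hν] at h
    simp only [hr] at h
    rw [← Complex.hasSum_ofReal]
    by_cases hm : ∀ j, 0 ≤ m j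
    · rw [if_pos ((hint m).2 hm)] at h
      rwa [if_pos hm, Complex.ofReal_one]
    · rw [if_neg (mt (hint m).1 hm)] at h
      rwa [if_neg hm, Complex.ofReal_zero]
  obtain ⟨hcone, hcone'⟩ := hasSum_cone (z := fun j => (α j : ℂ)) hα
  have hfib : ∀ m : Fin n → ℤ, HasSum (fun D => (r D m : ℂ) * ∏ j, ((α j ^ m j : ℂˣ) : ℂ))
      (if ∀ j, 0 ≤ m j then ∏ j, (α j : ℂ) ^ m j else 0) := by
    intro m
    have h := ((Complex.hasSum_ofReal).2 (hrsum m)).mul_right (∏ j, ((α j ^ m j : ℂˣ) : ℂ))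
    by_cases hm : ∀ j, 0 ≤ m j
    · simpa [hm] using h
    · simpa only [if_neg hm, Complex.ofReal_zero, zero_mul] using h
  have hfib' : ∀ m : Fin n → ℤ, HasSum (fun D => ‖(r D m : ℂ) * ∏ j, ((α j ^ m j : ℂˣ) : ℂ)‖)
      ‖if ∀ j, 0 ≤ m j then ∏ j, (α j : ℂ) ^ m j else 0‖ := by
    intro m
    have h := (hrsum m).mul_right ‖∏ j, ((α j ^ m j : ℂˣ) : ℂ)‖
    simp only [norm_mul, Complex.norm_of_nonneg (hr0 _ m)]
    by_cases hm : ∀ j, 0 ≤ m j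
    · simpa [hm] using h
    · simpa only [if_neg hm, norm_zero, zero_mul] using h
  -- As `r ≥ 0`, the norms for fixed `m` sum over `D` to the norm of the cone term, and these norms
  -- are summable over `m`.
  have hsummable : Summable fun p : (Fin n → ℤ) × DoubleCoset.Quotient
      (maxCompact n K : Set (GL (Fin n) K)) (maxCompact n K) =>
        (r p.2 p.1 : ℂ) * ∏ j, ((α j ^ p.1 j : ℂˣ) : ℂ) := by
    refine Summable.of_norm ((summable_prod_of_nonneg fun _ => norm_nonneg _).2
      ⟨fun m => (hfib' m).summable, ?_⟩)
    simpa only [(hfib' _).tsum_eq] using hcone'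
  -- Summing over `D` first evaluates the total as the cone series; summing over `m` first gives the
  -- scalars.
  have htotal := hsummable.hasSum.prod_fiberwise hfib
  rw [hcone.unique htotal]
  simp only [hr]
  have hswap := (Equiv.prodComm _ _).hasSum_iff.2 hsummable.hasSum
  exact hswap.prod_fiberwise fun D => (hswap.summable.prod_factor D).hasSum

end Satake

/-! ### The operator `π(f_0)` and its trace -/

section MainTheorem

variable {n : ℕ} {K : Type*} [Field K] [ValuativeRel K] [TopologicalSpace K]
  [IsNonarchimedeanLocalField K]

lemma indicator_mem_heckeAlgebra {f : GL (Fin n) K → ℂ}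
    (hf : ∀ k ∈ maxCompact n K, ∀ x, f (x * k) = f x ∧ f (k * x) = f x)
    (D : DoubleCoset.Quotient (maxCompact n K : Set (GL (Fin n) K)) (maxCompact n K)) :
    (DoubleCoset.quotToDoubleCoset (maxCompact n K) (maxCompact n K) D).indicator f ∈
      heckeAlgebra n K := by
  have := t2Space_of_localField K
  refine ⟨HasCompactSupport.intro (isCompact_quotToDoubleCoset (isCompact_maxCompact n K) D)
    fun x hx => Set.indicator_of_notMem hx _, fun k hk x => ⟨?_, ?_⟩⟩
  · exact indicator_eq_of_mem_iff (mul_mem_quotToDoubleCoset_right hk x D) (hf k hk x).1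
  · exact indicator_eq_of_mem_iff (mul_mem_quotToDoubleCoset_left hk x D) (hf k hk x).2

lemma localLFactor_eq (α : Fin n → ℂˣ) : localLFactor α = ∏ j, (1 - (α j : ℂ))⁻¹ := by
  rw [localLFactor, ← Matrix.diagonal_one, Matrix.diagonal_sub, Matrix.det_diagonal,
    Finset.prod_inv_distrib]

lemma norm_lt_one_of_satakeAbs_lt_one {α : Fin n → ℂˣ} (hα : satakeAbs α < 1) (j : Fin n) :
    ‖(α j : ℂ)‖ < 1 :=
  (le_ciSup (f := fun j => ‖(α j : ℂ)‖) (Set.finite_range _).bddAbove j).trans_lt hα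

variable [MeasurableSpace (GL (Fin n) K)] [BorelSpace (GL (Fin n) K)]
  {μ : Measure (GL (Fin n) K)} [μ.IsHaarMeasure] {ν : Measure (unipotent n K)} [ν.IsHaarMeasure]

theorem exists_hasOperatorSum (hμ : μ (maxCompact n K) = 1)
    (hν : ν (unipotentBox fun _ _ => 1) = 1) {ϖ : Kˣ} (hϖ : absK (ϖ : K) = (residueCard K : ℝ)⁻¹)
    {V : Type*} [NormedAddCommGroup V] [InnerProductSpace ℂ V] [CompleteSpace V]
    {π : GL (Fin n) K →* (V →L[ℂ] V)} (hπ : IsIrreducibleAdmissible π)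
    (hfix : fixedVectors π (maxCompact n K) ≠ ⊥) {α : Fin n → ℂˣ}
    (hsat : IsSatakeParameter μ ν ϖ π α) (hα : satakeAbs α < 1) :
    ∃ T : V →L[ℂ] V, HasOperatorSum (maxCompact n K) μ π (testFunction n K) T ∧
      IsTraceClass T ∧ HasTrace T (localLFactor α) := by
  have := locallyCompactSpace_GL n K
  have hopen := isOpen_maxCompact n K
  have hcpt := isCompact_maxCompact n K
  obtain ⟨v₀, hv₀, hv₀'⟩ := Submodule.exists_mem_ne_zero_of_ne_bot hfix
  obtain ⟨P, hP, hP', hPC, hPT⟩ := exists_projection hπ.continuous hopen hcpt hμ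
  -- Indicators of double cosets lie in the Hecke algebra, so the Satake parameters supply the
  -- scalars needed for multiplicity one.
  obtain ⟨u, hu, huv⟩ := exists_eq_rankOne hv₀' (hP' v₀ hv₀) fun w =>
    projection_mem_span (μ := μ) hπ hopen hcpt hP' hPC
      (fun D => ⟨_, hsat _ (indicator_mem_heckeAlgebra (fun _ _ _ => ⟨rfl, rfl⟩) D)⟩) hv₀ hv₀' w
  have hsum := (hasSum_scalars hϖ hν (norm_lt_one_of_satakeAbs_lt_one hα)).smul_const P
  rw [← localLFactor_eq] at hsum
  refine ⟨localLFactor α • P, ⟨_, fun D => ?_, hsum⟩, ?_, ?_⟩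
  rotate_left
  · rw [hu, ← smul_apply, ← map_smul]
    exact isTraceClass_rankOne _ _
  · have := hasTrace_rankOne (localLFactor α • v₀) u
    rwa [inner_smul_right, huv, mul_one, map_smul, smul_apply, ← hu] at this
  have hmem := indicator_mem_heckeAlgebra (f := testFunction n K)
    (fun k hk x => ⟨testFunction_mul_right hk x, testFunction_mul_left hk x⟩) D
  have hinv := fun k hk x => (hmem.2 k hk x).1
  obtain ⟨T, hT⟩ := exists_isIntegralOperator (μ := μ) hπ.continuous
    (continuous_of_forall_mul_eq hopen hinv) hmem.1
  intro v
  refine ⟨(hT v).1, ?_⟩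
  -- `T v = T (P v)` by right invariance, and `P v` is fixed by `C`, so `T` acts on it by the Satake
  -- scalar.
  rw [← (hT v).2, ← hPT _ T hmem.1 hinv hT v, (hT (P v)).2, hsat _ hmem _ (hP v), smul_apply]

end MainTheorem

end LocalGL

open LocalGL in
theorem proposition2p1 {K : Type*} [Field K] [ValuativeRel K] [TopologicalSpace K]
    [IsNonarchimedeanLocalField K] (n : ℕ)
    [MeasurableSpace (GL (Fin n) K)] [BorelSpace (GL (Fin n) K)]
    (μ : Measure (GL (Fin n) K)) [μ.IsHaarMeasure] (hμ : μ (maxCompact n K) = 1)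
    (ν : Measure (unipotent n K)) [ν.IsHaarMeasure]
    (hν : ν {u | (u : GL (Fin n) K) ∈ maxCompact n K} = 1)
    (ϖ : Kˣ) (hϖ : absK (ϖ : K) = (residueCard K : ℝ)⁻¹) :
    (∀ a : Fin n → Kˣ,
      Integrable (fun u : unipotent n K => testFunction n K (torus a * (u : GL (Fin n) K))) ν ∧
      satake ν (testFunction n K) a =
        open Classical in
        if (torus a : Matrix (Fin n) (Fin n) K) ∈ integralMatrices n K then 1 else 0) ∧
    ∀ {V : Type*} [NormedAddCommGroup V] [InnerProductSpace ℂ V] [CompleteSpace V]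
      (π : GL (Fin n) K →* (V →L[ℂ] V)), IsIrreducibleAdmissible π →
      fixedVectors π (maxCompact n K) ≠ ⊥ →
      ∀ α : Fin n → ℂˣ, IsSatakeParameter μ ν ϖ π α → satakeAbs α < 1 →
        ∃ T : V →L[ℂ] V, HasOperatorSum (maxCompact n K) μ π (testFunction n K) T ∧
          IsTraceClass T ∧ HasTrace T (localLFactor α) := by
  have hN : ν (unipotentBox fun _ _ => 1) = 1 := by
    rw [← hν]
    congr 1
    exact Set.ext fun u => (mem_maxCompact_iff_of_mem_unipotent u).symm
  exact ⟨fun a => ⟨integrable_testFunction hϖ hN a, satake_testFunction hϖ hN a⟩,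
    fun π hπ hfix α hsat hα => exists_hasOperatorSum hμ hN hϖ hπ hfix hsat hα⟩
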